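/- **Setting.** Consider $K$ arms; a pull of arm $i$ yields a reward drawn from a law $\nu_i$ carried by $[0,1]$, with mean $\mu_i$, independently over all pulls and arms. There is a unique best arm $i^*$; put $\mu^*=\mu_{i^*}$ and $\Delta_i=\mu^*-\mu_i$. Let $T\ge 2$ and $\alpha\in[0,1)$, and read $\frac{T^\alpha-1}{\alpha}$ as $\log T$ when $\alpha=0$. Let $I_t$ be the arm pulled in round $t\in\{1,\dots,T\}$, let $n_{i,t}$ be the number of pulls of arm $i$ in rounds $1,\dots,t$, let $\bar\mu_{i,t}$ be the average of the rewards received from arm $i$ in these rounds, and let $C_{i,t}=\sqrt{\frac{2(T^\alpha-1)}{\alpha\, n_{i,t}}}$ (with $C_{i,t}=\infty$ if $n_{i,t}=0$). The demonstrator runs one of two algorithms for $T$ rounds. * *SAE.* All arms are active at first. Each epoch pulls every active arm once, in any order; at the end of an epoch, at time $t$ say, if more than one arm is active, every active arm $i$ with $\bar\mu_{i,t}\le\max_{j\text{ active}}\bar\mu_{j,t}-2C_{i,t}$ is eliminated. Once one arm is left, it is pulled in all remaining rounds. * *UCB.* Round $t$ pulls an arm that maximizes $\bar\mu_{i,t-1}+C_{i,t-1}$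 (an arm not yet pulled has the value $\infty$; ties are broken arbitrarily). From $I_1,\dots,I_T$ and $\mu^*$ alone (and the knowledge of the algorithm, $\alpha$ and $T$), let $\hat\imath\in\arg\max_i n_{i,T}$ (ties broken arbitrarily), set $\hat\mu_{\hat\imath}=\mu^*$, and for $i\ne\hat\imath$ set * for SAE: $\hat\mu_i=\mu^*-2C_{i,\tau_i}$, where $\tau_i$ is the last round in which arm $i$ is pulled; * for UCB: $\hat\mu_i=\mu^*-(C_{i,\tau_i}-C_{\hat\imath,\tau_i})$, where $\tau_i=\max\{t: I_t=i\text{ and }I_{t'}=\hat\imath\text{ for some }t'>t\}$. **Theorem.** There are universal constants $C,c>0$ such that, in this setting, whenever $$T\ \ge\ 64\sum_{j\ne i^*}\frac{T^\alpha-1}{\alpha\,\Delta_j^2},$$ then, both for SAE and for UCB with the respective estimator, every suboptimal arm $i\neq i^*$ satisfies $$\mathbb E\,|\hat\mu_i-\mu_i|\ \le\ C\sqrt{\frac{\log\big(\mathbb E[n_{i,T}]\,\sqrt K\big)}{\mathbb E[n_{i,T}]}}\qquad\text{and}\qquad \mathbb E[n_{i,T}]\ \ge\ c\,\frac{T^\alpha-1}{\alpha\,\Delta_i^2}.$$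 -/

import Mathlib

open MeasureTheory ProbabilityTheory

namespace InverseBandit

noncomputable section

/-- A `K`-armed bandit instance: reward laws `ν i` that are probability measures carried by
`[0, 1]`. -/
structure BanditInstance (K : ℕ) where
  ν : Fin K → Measure ℝ
  isProbabilityMeasure : ∀ i, IsProbabilityMeasure (ν i)
  support : ∀ i, ∀ᵐ x ∂(ν i), x ∈ Set.Icc (0 : ℝ) 1

/-- The expected reward `μ i` of arm `i`. -/
def BanditInstance.mean {K : ℕ} (M : BanditInstance K) (i : Fin K) : ℝ := ∫ x, x ∂(M.ν i)

/-- `istar` is the unique arm of highest expected reward. -/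
def BanditInstance.IsUniqueBest {K : ℕ} (M : BanditInstance K) (istar : Fin K) : Prop :=
  ∀ j, j ≠ istar → M.mean j < M.mean istar

/-- The suboptimality gap `Δ i = μ istar - μ i`. -/
def BanditInstance.gap {K : ℕ} (M : BanditInstance K) (istar i : Fin K) : ℝ :=
  M.mean istar - M.mean i

/-- Reward tapes of length `T`: the samples `X i j`, for `i : Fin K` and `j < T`, are mutually
independent and `X i j` has law `ν i`. Cell `j` of the tape of arm `i` is the reward that the
`(j + 1)`-st pull of arm `i` yields. -/
def BanditInstance.IsRewardTape {K : ℕ} (M : BanditInstance K) (T : ℕ) {Ω : Type*}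
    [MeasurableSpace Ω] (P : Measure Ω) (X : Fin K → ℕ → Ω → ℝ) : Prop :=
  (∀ i, ∀ j < T, HasLaw (X i j) (M.ν i) P) ∧
    iIndepFun (fun p : Fin K × Fin T => X p.1 p.2) P

/-- `(T ^ α - 1) / α`, with its limit `log T` at `α = 0`. -/
def level (α : ℝ) (T : ℕ) : ℝ :=
  if α = 0 then Real.log T else ((T : ℝ) ^ α - 1) / α

/-- The confidence width of an arm that has been pulled `n ≥ 1` times. -/
def width (α : ℝ) (T n : ℕ) : ℝ := Real.sqrt (2 * level α T / n)

/-! An action sequence over `T` rounds is a map `a : Fin T → Fin K`; the entry `a t` is the arm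
pulled in round `t + 1`. "At time `t`" means after the first `t` rounds. -/

/-- The number of pulls of arm `i` up to time `t`. -/
def pulls {K T : ℕ} (a : Fin T → Fin K) (i : Fin K) (t : ℕ) : ℕ :=
  (Finset.univ.filter (fun s : Fin T => s.val < t ∧ a s = i)).card

/-- The empirical mean of arm `i` at time `t`, for actions `a` and received rewards `r`
(meaningful once arm `i` has been pulled). -/
def empMean {K T : ℕ} (a : Fin T → Fin K) (r : Fin T → ℝ) (i : Fin K) (t : ℕ) : ℝ :=
  (∑ s ∈ Finset.univ.filter (fun s : Fin T => s.val < t ∧ a s = i), r s) / (pulls a i t : ℝ)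

/-- The rewards received when the actions `a` are played on the tapes `x`: every pull of an arm
reads the next unread cell of the tape of that arm. -/
def tapeRewards {K T : ℕ} (x : Fin K → ℕ → ℝ) (a : Fin T → Fin K) : Fin T → ℝ :=
  fun t => x (a t) (pulls a (a t) t.val)

/-- Successive arm elimination, epoch by epoch (epochs counted from `0`): the time at which
epoch `e` begins, and the set of arms active in it. An epoch lasts one pull of each active arm.
At its end every active arm has been pulled `e + 1` times, and, as long as more than one arm is
active, an active arm is eliminated if its empirical mean is at most
(largest empirical mean of an active arm) `- 2 *` (confidence width). -/
def saeState {K T : ℕ} (α : ℝ) (a : Fin T → Fin K) (r : Fin T → ℝ) :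
    ℕ → ℕ × Finset (Fin K)
  | 0 => (0, Finset.univ)
  | e + 1 =>
    let S := (saeState α a r e).2
    let t := (saeState α a r e).1 + S.card
    open Classical in
    (t, if 1 < S.card then
          S.filter (fun i =>
            ¬ ∃ j ∈ S, empMean a r i t ≤ empMean a r j t - 2 * width α T (e + 1))
        else S)

/-- The actions `a`, with received rewards `r`, are those of successive arm elimination with
horizon `T`: each epoch pulls its active arms once each, in any order, until round `T`.
(Once a single arm is left it is pulled in every remaining round.) -/
def IsSAERun {K T : ℕ} (α : ℝ) (a : Fin T → Fin K) (r : Fin T → ℝ) : Prop :=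
  ∀ (e : ℕ) (t : Fin T),
    (saeState α a r e).1 ≤ t.val → t.val < (saeState α a r (e + 1)).1 →
      a t ∈ (saeState α a r e).2 ∧
        ∀ s : Fin T, (saeState α a r e).1 ≤ s.val → s < t → a s ≠ a t

/-- The upper confidence bound of arm `i` at time `t`; it is `∞` before the first pull. -/
def ucbIndex {K T : ℕ} (α : ℝ) (a : Fin T → Fin K) (r : Fin T → ℝ) (i : Fin K) (t : ℕ) : EReal :=
  if pulls a i t = 0 then ⊤ else ((empMean a r i t + width α T (pulls a i t) : ℝ) : EReal)

/-- The actions `a`, with received rewards `r`, are those of the UCB algorithm with horizon `T`: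
every round pulls an arm of maximal upper confidence bound, ties being broken in any way. -/
def IsUCBRun {K T : ℕ} (α : ℝ) (a : Fin T → Fin K) (r : Fin T → ℝ) : Prop :=
  ∀ (t : Fin T) (j : Fin K), ucbIndex α a r j t.val ≤ ucbIndex α a r (a t) t.val

/-- `ihat` selects, from the action sequence, an arm that is pulled most often. -/
def IsMostPulled {K T : ℕ} (ihat : (Fin T → Fin K) → Fin K) : Prop :=
  ∀ (a : Fin T → Fin K) (j : Fin K), pulls a j T ≤ pulls a (ihat a) T

/-- The switching round used for SAE: the last round in which arm `i` is pulled. -/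
def saeSwitch {K T : ℕ} (a : Fin T → Fin K) (i : Fin K) : ℕ :=
  (Finset.univ.filter (fun t : Fin T => a t = i)).sup (fun t => t.val + 1)

/-- The switching round used for UCB: the last round in which arm `i` is pulled and after which
arm `h` is pulled at least once. -/
def ucbSwitch {K T : ℕ} (a : Fin T → Fin K) (h i : Fin K) : ℕ :=
  (Finset.univ.filter (fun t : Fin T => a t = i ∧ ∃ t' : Fin T, t < t' ∧ a t' = h)).sup
    (fun t => t.val + 1)

/-- The SAE reward estimator. The arm `ihat a`, taken for the best one, gets the known value
`mustar`. -/
def saeEstimate {K T : ℕ} (α : ℝ) (ihat : (Fin T → Fin K) → Fin K) (mustar : ℝ)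
    (a : Fin T → Fin K) (i : Fin K) : ℝ :=
  if i = ihat a then mustar
  else mustar - 2 * width α T (pulls a i (saeSwitch a i))

/-- The UCB reward estimator. The arm `ihat a`, taken for the best one, gets the known value
`mustar`. -/
def ucbEstimate {K T : ℕ} (α : ℝ) (ihat : (Fin T → Fin K) → Fin K) (mustar : ℝ)
    (a : Fin T → Fin K) (i : Fin K) : ℝ :=
  if i = ihat a then mustar
  else mustar - (width α T (pulls a i (ucbSwitch a (ihat a) i))
    - width α T (pulls a (ihat a) (ucbSwitch a (ihat a) i)))

/-- The expected number of pulls of arm `i` in the `T` rounds. -/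
def expectedPulls {K T : ℕ} {Ω : Type*} [MeasurableSpace Ω] (P : Measure Ω)
    (I : Fin T → Ω → Fin K) (i : Fin K) : ℝ :=
  ∫ ω, (pulls (fun t => I t ω) i T : ℝ) ∂P

end

end InverseBandit

/-! Write L for `level α T`, w(n) for `width α T n`, Δ for the gap of arm i and λ = L/Δ² for its
`hardness`. With rewards read from tapes, an empirical mean is a tape average at the current pull
count. Bounds uniform over all counts therefore hold for every adaptive run, and on a good event the
analysis is deterministic.

The good event `WithinWidth` fails with probability at most 1/(16T), by Hoeffding and L ≥ log T. On
it a suboptimal arm is pulled between λ/64 and 33λ times. Since 64 times the total hardness is at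
most T, the best arm gets most of the rounds and is the one that `ihat` selects.

The actions then reveal Δ through two opposite comparisons one pull apart. In UCB, the last pull of
i that precedes a pull of the best arm bounds one index difference from one side, and the next pull
of the best arm bounds it from the other. In SAE, these are the survival of i in one epoch and its
elimination in the next. The estimate is therefore off by at most twice the deviation ε of the tape
averages, plus a width increment of order 1/λ (`ucb_deterministic`, `sae_deterministic`).

Only averages of at least a constant times λ cells enter, so `WithinEps` can be had with ε of order
√(log(λK)/λ), free of log T (`not_withinEps_le`). `expectation_bounds` integrates over the good and
bad events, and `sqrt_log_div_le` trades λ for the expected number of pulls. -/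

namespace InverseBandit

/-! ### Counting pulls -/

section Pulls

variable {K T : ℕ} (a : Fin T → Fin K)

@[simp]
lemma pulls_zero (i : Fin K) : pulls a i 0 = 0 := by simp [pulls]

lemma pulls_mono (i : Fin K) : Monotone (pulls a i) := fun _ _ h =>
  Finset.card_le_card fun s hs => by
    simp only [Finset.mem_filter, Finset.mem_univ, true_and] at hs ⊢
    exact ⟨hs.1.trans_le h, hs.2⟩

lemma filter_succ (i : Fin K) (t : Fin T) :
    (Finset.univ.filter fun s : Fin T => s.val < t.val + 1 ∧ a s = i) =
      if a t = i then insert t (Finset.univ.filter fun s : Fin T => s.val < t.val ∧ a s = i)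
      else Finset.univ.filter fun s : Fin T => s.val < t.val ∧ a s = i := by
  split_ifs with h
  · ext s
    simp only [Finset.mem_filter, Finset.mem_univ, true_and, Finset.mem_insert]
    constructor
    · rintro ⟨h1, h2⟩
      by_cases h3 : s.val = t.val
      · exact Or.inl (Fin.ext h3)
      · exact Or.inr ⟨by omega, h2⟩
    · rintro (rfl | h1)
      · exact ⟨by omega, h⟩
      · exact ⟨by omega, h1.2⟩
  · ext s
    simp only [Finset.mem_filter, Finset.mem_univ, true_and]
    constructor
    · rintro ⟨h1, h2⟩
      refine ⟨lt_of_le_of_ne (by omega) fun h3 => h ?_, h2⟩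
      obtain rfl : s = t := Fin.ext h3
      exact h2
    · exact fun h1 => ⟨by omega, h1.2⟩

lemma pulls_succ_self (t : Fin T) : pulls a (a t) (t.val + 1) = pulls a (a t) t.val + 1 := by
  unfold pulls
  rw [filter_succ, if_pos rfl, Finset.card_insert_of_notMem (by simp)]

lemma pulls_succ_of_ne {i : Fin K} {t : Fin T} (h : a t ≠ i) :
    pulls a i (t.val + 1) = pulls a i t.val := by
  unfold pulls
  rw [filter_succ, if_neg h]

lemma pulls_le (i : Fin K) (t : ℕ) : pulls a i t ≤ T :=
  (Finset.card_le_univ _).trans_eq (Fintype.card_fin T)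

lemma sum_pulls : ∑ i, pulls a i T = T := by
  have h := Finset.card_eq_sum_card_fiberwise (f := a) (s := Finset.univ) (t := Finset.univ)
    (fun _ _ => Finset.mem_coe.2 (Finset.mem_univ _))
  rw [Finset.card_fin] at h
  conv_rhs => rw [h]
  refine Finset.sum_congr rfl fun i _ => ?_
  unfold pulls
  congr 1
  ext s
  simp

/-- Every value of the pull count below the final one is the count just before some pull. -/
lemma exists_pull_eq {i : Fin K} {t k : ℕ} (ht : t ≤ T) (hk : k < pulls a i t) :
    ∃ s : Fin T, s.val < t ∧ a s = i ∧ pulls a i s.val = k := by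
  induction t with
  | zero => simp at hk
  | succ t ih =>
    by_cases h : k < pulls a i t
    · obtain ⟨s, hs, h1⟩ := ih (by omega) h
      exact ⟨s, by omega, h1⟩
    · by_cases hi : a ⟨t, ht⟩ = i
      · refine ⟨⟨t, ht⟩, by simp, hi, ?_⟩
        have := pulls_succ_self a ⟨t, ht⟩
        rw [hi] at this
        simp only at this ⊢
        omega
      · have := pulls_succ_of_ne a hi
        simp only at this
        omega

lemma pulls_lt_of_lt {s : Fin T} {t : ℕ} (h : s.val < t) :
    pulls a (a s) s.val < pulls a (a s) t := by
  have h1 := pulls_succ_self a s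
  have h2 := pulls_mono a (a s) (Nat.succ_le_of_lt h)
  simp only [Nat.succ_eq_add_one] at h2
  omega

/-- The pull count does not change over a stretch of rounds in which the arm is not pulled. -/
lemma pulls_eq_of_forall_ne {i : Fin K} {s t : ℕ} (hst : s ≤ t) (ht : t ≤ T)
    (h : ∀ u : Fin T, s ≤ u.val → u.val < t → a u ≠ i) : pulls a i t = pulls a i s := by
  refine le_antisymm (not_lt.1 fun hlt => ?_) (pulls_mono a i hst)
  obtain ⟨u, hu, hui, hue⟩ := exists_pull_eq a ht hlt
  by_cases hsu : s ≤ u.val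
  · exact h u hsu hu hui
  · have := pulls_lt_of_lt a (s := u) (t := s) (by omega)
    rw [hui] at this
    omega

end Pulls

/-! ### Averages along a reward tape -/

/-- The average of the first `n` cells of a tape. -/
noncomputable def tapeMean (x : ℕ → ℝ) (n : ℕ) : ℝ := (∑ j ∈ Finset.range n, x j) / n

/-- This removes adaptivity: the run influences the mean only through the count, so an event uniform
in the count controls every run. -/
lemma empMean_tapeRewards {K T : ℕ} (x : Fin K → ℕ → ℝ) (a : Fin T → Fin K) (i : Fin K) {t : ℕ}
    (ht : t ≤ T) : empMean a (tapeRewards x a) i t = tapeMean (x i) (pulls a i t) := by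
  unfold empMean tapeMean
  congr 1
  induction t with
  | zero => simp
  | succ t ih =>
    have hf := filter_succ a i ⟨t, ht⟩
    simp only at hf
    rw [hf]
    split_ifs with h
    · rw [Finset.sum_insert (by simp), ih (by omega)]
      have := pulls_succ_self a ⟨t, ht⟩
      rw [h] at this
      simp only at this
      rw [this, Finset.sum_range_succ, add_comm]
      simp [tapeRewards, h]
    · rw [ih (by omega)]
      have := pulls_succ_of_ne a h
      simp only at this
      rw [this]

/-- All averages along the tapes lie within `7 / 8` of a confidence width of the means. -/
def WithinWidth {K : ℕ} (α : ℝ) (T : ℕ) (μ : Fin K → ℝ) (x : Fin K → ℕ → ℝ) : Prop :=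
  ∀ j n, 1 ≤ n → n ≤ T → |tapeMean (x j) n - μ j| ≤ 7 / 8 * width α T n

/-- All averages of at least `b` and at most `T` cells lie within `ε` of the means. -/
def WithinEps {K : ℕ} (T : ℕ) (μ : Fin K → ℝ) (x : Fin K → ℕ → ℝ) (b ε : ℝ) : Prop :=
  ∀ j (n : ℕ), b ≤ n → n ≤ T → |tapeMean (x j) n - μ j| ≤ ε

/-! ### Confidence widths -/

section Width

variable {α : ℝ} {T : ℕ}

lemma width_nonneg (n : ℕ) : 0 ≤ width α T n := Real.sqrt_nonneg _

lemma width_sq (hL : 0 ≤ level α T) (n : ℕ) : width α T n ^ 2 = 2 * level α T / n :=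
  Real.sq_sqrt (by positivity)

lemma width_le (hL : 0 ≤ level α T) (n : ℕ) : width α T n ≤ Real.sqrt (2 * level α T) := by
  refine Real.sqrt_le_sqrt ?_
  -- At `n = 0` division by zero makes the width `0`, not infinite.
  rcases Nat.eq_zero_or_pos n with rfl | hn
  · simp [hL]
  · exact div_le_self (by positivity) (by exact_mod_cast hn)

/-- A lower bound on a width is an upper bound on the number of pulls. -/
lemma le_of_le_mul_width (hL : 0 ≤ level α T) {n : ℕ} (hn : 1 ≤ n) {q Δ : ℝ} (hΔ : 0 < Δ)
    (h : Δ ≤ q * width α T n) : (n : ℝ) ≤ 2 * q ^ 2 * (level α T / Δ ^ 2) := by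
  have hn' : (0 : ℝ) < n := by exact_mod_cast hn
  have h1 : Δ ^ 2 ≤ q ^ 2 * (2 * level α T / n) := by
    rw [← width_sq hL, ← mul_pow]
    gcongr
  have h2 : Δ ^ 2 * n ≤ q ^ 2 * (2 * level α T) := by
    calc Δ ^ 2 * n ≤ q ^ 2 * (2 * level α T / n) * n := by gcongr
      _ = _ := by field_simp
  rw [← mul_div_assoc, le_div_iff₀ (by positivity)]
  linarith

/-- An upper bound on a width is a lower bound on the number of pulls. -/
lemma le_mul_of_width_le (hL : 0 ≤ level α T) {n : ℕ} (hn : 1 ≤ n) {q Δ : ℝ} (hΔ : 0 < Δ)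
    (h : width α T n ≤ q * Δ) : 2 * (level α T / Δ ^ 2) ≤ q ^ 2 * n := by
  have hn' : (0 : ℝ) < n := by exact_mod_cast hn
  have h1 : 2 * level α T / n ≤ q ^ 2 * Δ ^ 2 := by
    rw [← width_sq hL, ← mul_pow]
    gcongr
    exact width_nonneg n
  rw [div_le_iff₀ hn'] at h1
  rw [← mul_div_assoc, div_le_iff₀ (by positivity)]
  linarith

lemma width_le_mul {n : ℕ} {q Δ : ℝ} (hn : 1 ≤ n) (hq : 0 ≤ q) (hΔ : 0 < Δ)
    (h : 2 * (level α T / Δ ^ 2) ≤ q ^ 2 * n) : width α T n ≤ q * Δ := by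
  have hn' : (0 : ℝ) < n := by exact_mod_cast hn
  refine Real.sqrt_le_iff.2 ⟨by positivity, ?_⟩
  rw [← mul_div_assoc, div_le_iff₀ (by positivity)] at h
  rw [div_le_iff₀ hn']
  linarith [mul_pow q Δ 2]

/-- Consecutive widths differ by a fraction `1 / n`. -/
lemma width_sub_le (hL : 0 ≤ level α T) {n : ℕ} (hn : 1 ≤ n) :
    width α T n - width α T (n + 1) ≤ 2 * width α T (n + 1) / (n + 1 : ℝ) := by
  have hn' : (1 : ℝ) ≤ n := by exact_mod_cast hn
  have h0 := width_nonneg (α := α) (T := T) (n + 1)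
  have h1 : width α T n ≤ (1 + 2 / (n + 1 : ℝ)) * width α T (n + 1) := by
    refine Real.sqrt_le_iff.2 ⟨by positivity, ?_⟩
    rw [mul_pow, width_sq hL]
    push_cast
    rw [← mul_div_assoc, div_le_div_iff₀ (by positivity) (by positivity)]
    have h2 : (n + 1 : ℝ) ≤ (1 + 2 / (n + 1 : ℝ)) ^ 2 * n := by
      have : (1 + 2 / (n + 1 : ℝ)) ^ 2 * n = (n + 3) ^ 2 * n / (n + 1) ^ 2 := by
        field_simp; ring
      rw [this, le_div_iff₀ (by positivity)]
      nlinarith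
    nlinarith
  calc _ ≤ (1 + 2 / (n + 1 : ℝ)) * width α T (n + 1) - width α T (n + 1) := by linarith
    _ = _ := by ring

end Width

/-! ### The regime of the theorem -/

/-- The number of pulls, up to a constant, that tells arm `i` from the best arm. -/
noncomputable def hardness {K : ℕ} (α : ℝ) (T : ℕ) (μ : Fin K → ℝ) (istar i : Fin K) : ℝ :=
  level α T / (μ istar - μ i) ^ 2

/-- Means in `[0, 1]` with a unique best arm, and a horizon that is long compared with the total
hardness of the suboptimal arms. -/
structure LongHorizon {K : ℕ} (α : ℝ) (T : ℕ) (μ : Fin K → ℝ) (istar : Fin K) : Prop where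
  mem : ∀ j, μ j ∈ Set.Icc (0 : ℝ) 1
  best : ∀ j, j ≠ istar → μ j < μ istar
  one_le_level : 1 ≤ level α T
  le_horizon : 64 ≤ T
  sum_hardness : 64 * ∑ j ∈ Finset.univ.erase istar, hardness α T μ istar j ≤ T

namespace LongHorizon

variable {K T : ℕ} {α : ℝ} {μ : Fin K → ℝ} {istar i : Fin K}

lemma gap_pos (h : LongHorizon α T μ istar) (hi : i ≠ istar) : 0 < μ istar - μ i :=
  sub_pos.2 (h.best i hi)

lemma gap_le_one (h : LongHorizon α T μ istar) : μ istar - μ i ≤ 1 := by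
  linarith [(h.mem istar).2, (h.mem i).1]

lemma mean_le (h : LongHorizon α T μ istar) (j : Fin K) : μ j ≤ μ istar := by
  rcases eq_or_ne j istar with rfl | hj
  · exact le_rfl
  · exact (h.best j hj).le

lemma level_nonneg (h : LongHorizon α T μ istar) : 0 ≤ level α T :=
  zero_le_one.trans h.one_le_level

lemma level_le_hardness (h : LongHorizon α T μ istar) (hi : i ≠ istar) :
    level α T ≤ hardness α T μ istar i := by
  have h1 := h.gap_pos hi
  have h2 : (μ istar - μ i) ^ 2 ≤ 1 := pow_le_one₀ h1.le h.gap_le_one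
  exact le_div_self h.level_nonneg (by positivity) h2

lemma one_le_hardness (h : LongHorizon α T μ istar) (hi : i ≠ istar) :
    1 ≤ hardness α T μ istar i :=
  h.one_le_level.trans (h.level_le_hardness hi)

lemma hardness_le (h : LongHorizon α T μ istar) (hi : i ≠ istar) :
    64 * hardness α T μ istar i ≤ T := by
  refine le_trans ?_ h.sum_hardness
  gcongr
  exact Finset.single_le_sum (f := fun j => hardness α T μ istar j)
    (fun j hj => zero_le_one.trans (h.one_le_hardness (Finset.ne_of_mem_erase hj)))
    (Finset.mem_erase.2 ⟨hi, Finset.mem_univ i⟩)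

/-- If the suboptimal arms are pulled at most `q` times their hardness, then the best arm gets the
remaining rounds. -/
lemma le_pulls_best (h : LongHorizon α T μ istar) {a : Fin T → Fin K} {q : ℝ} (hq : 0 ≤ q)
    (ha : ∀ j, j ≠ istar → (pulls a j T : ℝ) ≤ q * hardness α T μ istar j) :
    (1 - q / 64) * T ≤ pulls a istar T := by
  have h1 : (∑ j, (pulls a j T : ℝ)) = T := by exact_mod_cast sum_pulls a
  rw [← Finset.add_sum_erase _ _ (Finset.mem_univ istar)] at h1
  have h2 : ∑ j ∈ Finset.univ.erase istar, (pulls a j T : ℝ) ≤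
      q * ∑ j ∈ Finset.univ.erase istar, hardness α T μ istar j := by
    rw [Finset.mul_sum]
    exact Finset.sum_le_sum fun j hj => ha j (Finset.ne_of_mem_erase hj)
  have h3 := mul_le_mul_of_nonneg_left h.sum_hardness hq
  linarith

/-- Then the best arm is also the one pulled most often. -/
lemma mostPulled_eq (h : LongHorizon α T μ istar) {a : Fin T → Fin K} {q : ℝ} (hq : 0 ≤ q)
    (hq' : q < 32) (ha : ∀ j, j ≠ istar → (pulls a j T : ℝ) ≤ q * hardness α T μ istar j)
    {ihat : (Fin T → Fin K) → Fin K} (hihat : IsMostPulled ihat) : ihat a = istar := by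
  -- Another arm has at most qT/64 pulls and the best arm at least (1 - q/64)T, which is more
  -- exactly when q < 32.
  by_contra hne
  have h1 : (pulls a istar T : ℝ) ≤ pulls a (ihat a) T := by exact_mod_cast hihat a istar
  have h2 := ha _ hne
  have h3 := h.le_pulls_best hq ha
  have h4 := mul_le_mul_of_nonneg_left (h.hardness_le hne) hq
  have h5 : (64 : ℝ) ≤ T := by exact_mod_cast h.le_horizon
  nlinarith

end LongHorizon

/-! ### Runs of the UCB algorithm -/

section UCB

variable {K T : ℕ} {α : ℝ} {a : Fin T → Fin K} {x : Fin K → ℕ → ℝ}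

/-- The pulled arm has a finite maximal index, so no index is infinite and every arm has already
been pulled. -/
lemma IsUCBRun.index_le (hrun : IsUCBRun α a (tapeRewards x a)) (t : Fin T) (j : Fin K)
    (ht : 1 ≤ pulls a (a t) t.val) :
    1 ≤ pulls a j t.val ∧
      tapeMean (x j) (pulls a j t.val) + width α T (pulls a j t.val) ≤
        tapeMean (x (a t)) (pulls a (a t) t.val) + width α T (pulls a (a t) t.val) := by
  have h := hrun t j
  unfold ucbIndex at h
  rw [if_neg (by omega : ¬ pulls a (a t) t.val = 0)] at h
  split_ifs at h with h0
  · exact absurd h (not_le.2 (EReal.coe_lt_top _))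
  · rw [empMean_tapeRewards _ _ _ t.2.le, empMean_tapeRewards _ _ _ t.2.le] at h
    exact ⟨by omega, EReal.coe_le_coe_iff.1 h⟩

variable {μ : Fin K → ℝ} {istar i : Fin K}

/-- At the last pull of i, made after n earlier ones, the comparison with the best arm gives Δ ≤
15/8 · w(n): one width and 7/8 of deviation. The deviation of the best arm is absorbed by its own
width. So n ≤ 7.04λ, and the last pull adds 1 ≤ λ. -/
lemma IsUCBRun.pulls_le (h : LongHorizon α T μ istar) (hx : WithinWidth α T μ x)
    (hrun : IsUCBRun α a (tapeRewards x a)) (hi : i ≠ istar) :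
    (pulls a i T : ℝ) ≤ 9 * hardness α T μ istar i := by
  have h1 := h.one_le_hardness hi
  rcases Nat.lt_or_ge (pulls a i T) 2 with hlt | hge
  · have : (pulls a i T : ℝ) ≤ 1 := by exact_mod_cast (by omega : pulls a i T ≤ 1)
    linarith
  · obtain ⟨n, hn⟩ : ∃ n, pulls a i T = n + 1 := ⟨pulls a i T - 1, by omega⟩
    obtain ⟨t, -, hti, htn⟩ := exists_pull_eq a (i := i) (k := n) le_rfl (by omega)
    obtain ⟨hm, hle⟩ := hrun.index_le t istar (by rw [hti]; omega)
    rw [hti, htn] at hle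
    have h2 := abs_le.1 (hx i n (by omega) (by have := InverseBandit.pulls_le a i T; omega))
    have h3 := abs_le.1 (hx istar _ hm (InverseBandit.pulls_le a istar _))
    have h4 := width_nonneg (α := α) (T := T) (pulls a istar t.val)
    have h5 := le_of_le_mul_width h.level_nonneg (n := n) (by omega) (h.gap_pos hi) (q := 15 / 8)
      (by linarith)
    rw [hn]
    push_cast
    unfold hardness at h1 ⊢
    linarith

/-- The constants 64, 33, 28800 and 1600 are shared with `sae_deterministic`, so that
`expectation_bounds` serves both algorithms. -/
lemma ucb_deterministic (h : LongHorizon α T μ istar) (hx : WithinWidth α T μ x)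
    (hrun : IsUCBRun α a (tapeRewards x a)) {ihat : (Fin T → Fin K) → Fin K}
    (hihat : IsMostPulled ihat) (hi : i ≠ istar) :
    hardness α T μ istar i / 64 ≤ pulls a i T ∧
      (pulls a i T : ℝ) ≤ 33 * hardness α T μ istar i ∧
      ∀ ε, WithinEps T μ x (hardness α T μ istar i / 28800) ε →
        |ucbEstimate α ihat (μ istar) a i - μ i| ≤ 2 * ε + 1600 / hardness α T μ istar i := by
  have hub : ∀ j, j ≠ istar → (pulls a j T : ℝ) ≤ 9 * hardness α T μ istar j :=
    fun j hj => hrun.pulls_le h hx hj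
  have hhat : ihat a = istar := h.mostPulled_eq (by norm_num) (by norm_num) hub hihat
  have hstar := h.le_pulls_best (by norm_num) hub
  have hL := h.level_nonneg
  have hΔ := h.gap_pos hi
  have hlam := h.one_le_hardness hi
  have hlamT := h.hardness_le hi
  have hlamL := h.level_le_hardness hi
  have hT : (64 : ℝ) ≤ T := by exact_mod_cast h.le_horizon
  have hdef : level α T / (μ istar - μ i) ^ 2 = hardness α T μ istar i := rfl
  set lam := hardness α T μ istar i with hlamdef
  -- the last pull of the best arm
  obtain ⟨M, hM⟩ : ∃ M, pulls a istar T = M + 1 := by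
    refine ⟨pulls a istar T - 1, ?_⟩
    have : (1 : ℝ) ≤ pulls a istar T := by linarith
    have : 1 ≤ pulls a istar T := by exact_mod_cast this
    omega
  obtain ⟨v, -, hv, hvM⟩ := exists_pull_eq a (i := istar) (k := M) le_rfl (by omega)
  have hM54 : 54 * lam ≤ M := by
    rw [hM] at hstar; push_cast at hstar; linarith
  have hM1 : 1 ≤ M := by
    have : (1 : ℝ) ≤ M := by linarith
    exact_mod_cast this
  obtain ⟨hn1, hvle⟩ := hrun.index_le v i (by rw [hv]; omega)
  rw [hv, hvM] at hvle
  obtain ⟨n, hn⟩ : ∃ n, pulls a i v.val = n := ⟨_, rfl⟩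
  rw [hn] at hn1 hvle
  have hnT : n ≤ T := hn ▸ pulls_le a i _
  have hn1' : (1 : ℝ) ≤ n := by exact_mod_cast hn1
  -- the lower bound on the pulls of arm `i`
  have hnlam : lam / 64 ≤ n := by
    have h1 := abs_le.1 (hx i n hn1 hnT)
    have h2 := abs_le.1 (hx istar M hM1 (by have := pulls_le a istar T; omega))
    have h3 : width α T M ≤ 1 / 5 * (μ istar - μ i) :=
      width_le_mul hM1 (by norm_num) hΔ (by rw [hdef]; linarith)
    -- The comparison at v reads w(n)/8 ≤ Δ + 15/8 · Δ/5 = 11/8 · Δ, and 2/121 ≥ 1/64.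
    have h4 := le_mul_of_width_le hL hn1 hΔ (q := 11) (by linarith)
    rw [hdef] at h4
    linarith
  have hnle : n ≤ pulls a i T := hn ▸ pulls_mono a i v.2.le
  refine ⟨hnlam.trans (by exact_mod_cast hnle), (hub i hi).trans (by linarith), fun ε hε => ?_⟩
  -- the switching round
  set F := Finset.univ.filter fun t : Fin T => a t = i ∧ ∃ t' : Fin T, t < t' ∧ a t' = istar
    with hF
  have hFne : F.Nonempty := by
    obtain ⟨s, hs, hsi, -⟩ := exists_pull_eq a (i := i) (k := 0) v.2.le (by omega)
    refine ⟨s, ?_⟩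
    simp only [hF, Finset.mem_filter, Finset.mem_univ, true_and]
    exact ⟨hsi, v, hs, hv⟩
  obtain ⟨s, hsF, hsup⟩ := Finset.exists_mem_eq_sup F hFne (fun t => t.val + 1)
  have hswitch : ucbSwitch a istar i = s.val + 1 := hsup
  have hmax : ∀ u : Fin T, a u = i → (∃ t' : Fin T, u < t' ∧ a t' = istar) → u ≤ s := by
    intro u hu hu'
    have := Finset.le_sup (f := fun t : Fin T => t.val + 1)
      (show u ∈ F by simp only [hF, Finset.mem_filter, Finset.mem_univ, true_and]; exact ⟨hu, hu'⟩)
    rw [hsup] at this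
    exact Fin.le_def.2 (by omega)
  obtain ⟨hsi, w, hsw, hwi⟩ : a s = i ∧ ∃ t' : Fin T, s < t' ∧ a t' = istar := by
    simpa [hF] using hsF
  have hsv : s < v := by
    refine hsw.trans_le (Fin.le_def.2 (not_lt.1 fun hlt => ?_))
    have := pulls_lt_of_lt a hlt
    rw [hv, hvM] at this
    have h2 := pulls_lt_of_lt a w.2
    rw [hwi] at h2
    omega
  -- the first pull of the best arm after the switching round
  set m := pulls a istar (s.val + 1) with hm
  have hms : pulls a istar s.val = m := (pulls_succ_of_ne a (by rw [hsi]; exact hi)).symm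
  have hmT : m < pulls a istar T := by
    have h1 := pulls_lt_of_lt a v.2
    rw [hv] at h1
    exact (pulls_mono a istar (Nat.succ_le_of_lt (Fin.lt_def.1 hsv))).trans_lt h1
  obtain ⟨u, -, hu, hum⟩ := exists_pull_eq a le_rfl hmT
  have hsu : s < u := by
    refine not_le.1 fun hle => ?_
    have h1 := pulls_lt_of_lt a (s := u) (t := s.val + 1) (by have := Fin.le_def.1 hle; omega)
    rw [hu, hum] at h1
    omega
  have huv : u.val ≤ v.val := by
    refine not_lt.1 fun hlt => ?_
    have h1 := pulls_lt_of_lt a hlt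
    have h2 := pulls_mono a istar (Nat.succ_le_of_lt (Fin.lt_def.1 hsv))
    rw [hv, hum] at h1
    simp only [Nat.succ_eq_add_one] at h2
    omega
  -- A pull of i strictly between s and v would be followed by v, against the maximality of s. So i
  -- keeps the count n from s + 1 up to v, in particular at u.
  have hconst : pulls a i v.val = pulls a i (s.val + 1) :=
    pulls_eq_of_forall_ne a (Nat.succ_le_of_lt (Fin.lt_def.1 hsv)) v.2.le fun z hz hzv hzi => by
      have := Fin.le_def.1 (hmax z hzi ⟨v, hzv, hv⟩)
      omega
  have hsn : pulls a i (s.val + 1) = n := hconst.symm.trans hn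
  have hun : pulls a i u.val = n := le_antisymm
    (hn ▸ pulls_mono a i huv) (hsn ▸ pulls_mono a i (Nat.succ_le_of_lt (Fin.lt_def.1 hsu)))
  have hsn' : pulls a i s.val + 1 = n := by
    have := pulls_succ_self a s
    rw [hsi] at this
    omega
  have hest : ucbEstimate α ihat (μ istar) a i - μ i =
      (μ istar - μ i) - (width α T n - width α T m) := by
    unfold ucbEstimate
    rw [hhat, if_neg hi, hswitch, hsn, ← hm]
    ring
  rw [hest]
  have hwn : width α T n ≤ 12 * (μ istar - μ i) :=
    width_le_mul hn1 (by norm_num) hΔ (by rw [hdef]; linarith)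
  have hΔ1 : μ istar - μ i ≤ 1 := h.gap_le_one
  have hε0 : 0 ≤ ε := (abs_nonneg _).trans (hε istar T (by linarith) le_rfl)
  rcases Nat.lt_or_ge n 2 with hlt | hge
  -- Here s is the first pull of i, so its index was infinite and yields no comparison. But λ ≤ 64,
  -- and the term 1600/λ ≥ 25 exceeds the trivial error.
  · obtain rfl : n = 1 := by omega
    have hlam64 : lam ≤ 64 := by push_cast at hnlam; linarith
    have hw : ∀ k, width α T k ≤ 12 := fun k => (width_le hL k).trans
      (Real.sqrt_le_iff.2 ⟨by norm_num, by linarith⟩)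
    have h1 : (25 : ℝ) ≤ 1600 / lam := by rw [le_div_iff₀ (by linarith)]; linarith
    have := hw 1
    have := hw m
    have := width_nonneg (α := α) (T := T) 1
    have := width_nonneg (α := α) (T := T) m
    rw [abs_le]
    constructor <;> linarith
  · obtain ⟨k, rfl⟩ : ∃ k, n = k + 1 := ⟨n - 1, by omega⟩
    have hsk : pulls a i s.val = k := by omega
    have hk1 : 1 ≤ k := by omega
    have hk1' : (1 : ℝ) ≤ k := by exact_mod_cast hk1
    obtain ⟨hm1, hsle⟩ := hrun.index_le s istar (by rw [hsi]; omega)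
    rw [hsi, hsk, hms] at hsle
    rw [hms] at hm1
    obtain ⟨-, hule⟩ := hrun.index_le u i (by rw [hu]; omega)
    rw [hu, hum, hun] at hule
    have hmT' : m ≤ T := by have := pulls_le a istar T; omega
    push_cast at hnlam
    -- the best arm has been pulled sufficiently often
    have hmlam : lam / 28800 ≤ m := by
      have h1 := abs_le.1 (hx i k hk1 (by omega))
      have h2 := abs_le.1 (hx istar m hm1 hmT')
      have h3 : width α T k ≤ 12 * √2 * (μ istar - μ i) := by
        refine width_le_mul hk1 (by positivity) hΔ ?_
        rw [hdef, mul_pow, Real.sq_sqrt (by norm_num)]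
        linarith
      have h4 : √2 ≤ 3 / 2 := Real.sqrt_le_iff.2 ⟨by norm_num, by norm_num⟩
      -- At s the comparison gives w(m)/8 ≤ 15/8 · w(k), hence k ≤ 225m. With k ≥ n/2 ≥ λ/128 this
      -- explains 28800 = 128 · 225.
      have h5 : width α T m ≤ 15 * width α T k := by linarith
      have h6 : width α T m ^ 2 ≤ 225 * width α T k ^ 2 := by
        have := pow_le_pow_left₀ (width_nonneg m) h5 2
        linarith [mul_pow 15 (width α T k) 2]
      rw [width_sq hL, width_sq hL, ← mul_div_assoc,
        div_le_div_iff₀ (by exact_mod_cast hm1) (by positivity)] at h6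
      have hLpos : 0 < level α T := zero_lt_one.trans_le h.one_le_level
      have h7 : (k : ℝ) ≤ 225 * m := by
        have : level α T * k ≤ level α T * (225 * m) := by linarith
        exact le_of_mul_le_mul_left this hLpos
      linarith
    -- The rounds s and u enclose the same index of the best arm, at count m, between the indices of
    -- i at counts k + 1 and k. This pins Δ - (w(n) - w(m)) up to 2ε and w(k) - w(k + 1).
    have e1 := abs_le.1 (hε i k (by linarith) (by omega))
    have e2 := abs_le.1 (hε i (k + 1) (by push_cast; linarith) hnT)
    have e3 := abs_le.1 (hε istar m hmlam hmT')
    have e4 := width_sub_le hL hk1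
    have e5 : 2 * width α T (k + 1) / (k + 1 : ℝ) ≤ 1600 / lam := by
      rw [div_le_div_iff₀ (by positivity) (by linarith)]
      have : 2 * width α T (k + 1) * lam ≤ 24 * lam := by
        gcongr
        linarith
      linarith
    have e6 : 0 ≤ 1600 / lam := by positivity
    rw [abs_le]
    constructor <;> linarith

end UCB

/-! ### Runs of successive arm elimination -/

section SAE

variable {K T : ℕ} {α : ℝ} {a : Fin T → Fin K} {r : Fin T → ℝ} {x : Fin K → ℕ → ℝ}

lemma saeState_succ_fst (e : ℕ) :
    (saeState α a r (e + 1)).1 = (saeState α a r e).1 + (saeState α a r e).2.card := rfl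

lemma mem_saeState_succ {e : ℕ} {i : Fin K} :
    i ∈ (saeState α a r (e + 1)).2 ↔ i ∈ (saeState α a r e).2 ∧
      (1 < (saeState α a r e).2.card → ∀ j ∈ (saeState α a r e).2,
        empMean a r j (saeState α a r (e + 1)).1 - 2 * width α T (e + 1) <
          empMean a r i (saeState α a r (e + 1)).1) := by
  classical
  rw [saeState_succ_fst]
  simp only [saeState]
  split_ifs with h
  · simp only [Finset.mem_filter, not_exists, not_and, not_le, h, true_imp_iff]
  · simp [h]

lemma saeState_succ_subset (e : ℕ) : (saeState α a r (e + 1)).2 ⊆ (saeState α a r e).2 :=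
  fun _ h => (mem_saeState_succ.1 h).1

lemma saeState_subset {e e' : ℕ} (h : e ≤ e') : (saeState α a r e').2 ⊆ (saeState α a r e).2 := by
  induction e', h using Nat.le_induction with
  | base => exact subset_rfl
  | succ n _ ih => exact (saeState_succ_subset n).trans ih

lemma saeState_fst_mono : Monotone fun e => (saeState α a r e).1 :=
  monotone_nat_of_le_succ fun e => by rw [saeState_succ_fst]; omega

/-- An arm of largest empirical mean survives because the width is positive. Hence each epoch takes
at least one round, and the epochs exhaust the horizon. -/
lemma saeState_nonempty [Nonempty (Fin K)] (hL : 0 < level α T) (e : ℕ) :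
    (saeState α a r e).2.Nonempty := by
  induction e with
  | zero => exact Finset.univ_nonempty
  | succ e ih =>
    obtain ⟨i, hi, hmax⟩ := Finset.exists_max_image _
      (fun i => empMean a r i (saeState α a r (e + 1)).1) ih
    refine ⟨i, mem_saeState_succ.2 ⟨hi, fun _ j hj => ?_⟩⟩
    have h1 : 0 < width α T (e + 1) := Real.sqrt_pos.2 (by positivity)
    linarith [hmax j hj]

lemma le_saeState_fst [Nonempty (Fin K)] (hL : 0 < level α T) (e : ℕ) :
    e ≤ (saeState α a r e).1 := by
  induction e with
  | zero => exact Nat.zero_le _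
  | succ e ih =>
    have := (saeState_nonempty (a := a) (r := r) hL e).card_pos
    rw [saeState_succ_fst]
    omega

/-- Every round belongs to an epoch. -/
lemma exists_epoch [Nonempty (Fin K)] (hL : 0 < level α T) (s : ℕ) :
    ∃ e, (saeState α a r e).1 ≤ s ∧ s < (saeState α a r (e + 1)).1 := by
  classical
  have hex : ∃ e, s < (saeState α a r e).1 := ⟨s + 1, le_saeState_fst hL (s + 1)⟩
  have h0 : Nat.find hex ≠ 0 := fun h => by
    have := Nat.find_spec hex
    rw [h] at this
    exact absurd this (Nat.not_lt_zero _)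
  obtain ⟨e, he⟩ := Nat.exists_eq_succ_of_ne_zero h0
  refine ⟨e, not_lt.1 (Nat.find_min hex (by omega)), ?_⟩
  have := Nat.find_spec hex
  rwa [he] at this

/-- Two rounds of one epoch pull different arms. -/
lemma IsSAERun.eq_of_epoch (hrun : IsSAERun α a r) {e : ℕ} {s t : Fin T}
    (hs : (saeState α a r e).1 ≤ s.val) (hs' : s.val < (saeState α a r (e + 1)).1)
    (ht : (saeState α a r e).1 ≤ t.val) (ht' : t.val < (saeState α a r (e + 1)).1)
    (h : a s = a t) : s = t := by
  rcases lt_trichotomy s t with hst | hst | hst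
  · exact absurd h ((hrun e t ht ht').2 s hs hst)
  · exact hst
  · exact absurd h.symm ((hrun e s hs hs').2 t ht hst)

/-- Pigeonhole: a complete epoch has as many rounds as active arms and pulls distinct active arms,
hence all of them. -/
lemma IsSAERun.exists_pull (hrun : IsSAERun α a r) {e : ℕ} (he : (saeState α a r (e + 1)).1 ≤ T)
    {j : Fin K} (hj : j ∈ (saeState α a r e).2) :
    ∃ s : Fin T, (saeState α a r e).1 ≤ s.val ∧ s.val < (saeState α a r (e + 1)).1 ∧ a s = j := by
  classical
  set F := Finset.univ.filter fun s : Fin T =>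
    (saeState α a r e).1 ≤ s.val ∧ s.val < (saeState α a r (e + 1)).1 with hF
  have hmemF : ∀ s, s ∈ F ↔ (saeState α a r e).1 ≤ s.val ∧ s.val < (saeState α a r (e + 1)).1 := by
    simp [hF]
  have hcard : F.card = (saeState α a r e).2.card := by
    have h1 : F.map Fin.valEmbedding =
        Finset.Ico (saeState α a r e).1 (saeState α a r (e + 1)).1 := by
      ext k
      simp only [Finset.mem_map, hmemF, Fin.valEmbedding_apply, Finset.mem_Ico]
      exact ⟨by rintro ⟨s, hs, rfl⟩; exact hs, fun hk => ⟨⟨k, hk.2.trans_le he⟩, hk, rfl⟩⟩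
    have h2 := congrArg Finset.card h1
    rw [Finset.card_map, Nat.card_Ico, saeState_succ_fst] at h2
    omega
  have himage : F.image a = (saeState α a r e).2 := by
    refine Finset.eq_of_subset_of_card_le (fun k hk => ?_) ?_
    · obtain ⟨s, hs, rfl⟩ := Finset.mem_image.1 hk
      have := (hmemF s).1 hs
      exact (hrun e s this.1 this.2).1
    · rw [Finset.card_image_of_injOn, hcard]
      intro s hs t ht h
      have hs := (hmemF s).1 hs
      have ht := (hmemF t).1 ht
      exact hrun.eq_of_epoch hs.1 hs.2 ht.1 ht.2 h
  rw [← himage] at hj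
  obtain ⟨s, hs, rfl⟩ := Finset.mem_image.1 hj
  have := (hmemF s).1 hs
  exact ⟨s, this.1, this.2, rfl⟩

lemma IsSAERun.pulls_epoch_succ (hrun : IsSAERun α a r) {e : ℕ}
    (he : (saeState α a r (e + 1)).1 ≤ T) {j : Fin K} (hj : j ∈ (saeState α a r e).2) :
    pulls a j (saeState α a r (e + 1)).1 = pulls a j (saeState α a r e).1 + 1 := by
  obtain ⟨s, hs, hs', rfl⟩ := hrun.exists_pull he hj
  have h1 : pulls a (a s) s.val = pulls a (a s) (saeState α a r e).1 :=
    pulls_eq_of_forall_ne a hs s.2.le fun u hu hus h => by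
      have := hrun.eq_of_epoch hu (hus.trans hs') hs hs' h
      omega
  have h2 : pulls a (a s) (saeState α a r (e + 1)).1 = pulls a (a s) (s.val + 1) :=
    pulls_eq_of_forall_ne a hs' he fun u hu hus h => by
      have := hrun.eq_of_epoch (by omega) hus hs hs' h
      omega
  rw [h2, pulls_succ_self, h1]

/-- An arm that is active in epoch `e` has been pulled once in each previous epoch. -/
lemma IsSAERun.pulls_epoch (hrun : IsSAERun α a r) {e : ℕ} (he : (saeState α a r e).1 ≤ T)
    {j : Fin K} (hj : j ∈ (saeState α a r e).2) : pulls a j (saeState α a r e).1 = e := by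
  induction e with
  | zero => exact pulls_zero a j
  | succ e ih =>
    have hj' := saeState_succ_subset e hj
    rw [hrun.pulls_epoch_succ he hj', ih ((saeState_fst_mono (Nat.le_succ e)).trans he) hj']

/-- The epoch of a pull is the number of previous pulls of the same arm. -/
lemma IsSAERun.epoch_pull [Nonempty (Fin K)] (hL : 0 < level α T) (hrun : IsSAERun α a r)
    (s : Fin T) : (saeState α a r (pulls a (a s) s.val)).1 ≤ s.val ∧
      a s ∈ (saeState α a r (pulls a (a s) s.val)).2 := by
  obtain ⟨e, hs, hs'⟩ := exists_epoch (a := a) (r := r) hL s.val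
  have hmem := (hrun e s hs hs').1
  have h1 : pulls a (a s) s.val = pulls a (a s) (saeState α a r e).1 :=
    pulls_eq_of_forall_ne a hs s.2.le fun u hu hus h => by
      have := hrun.eq_of_epoch hu (hus.trans hs') hs hs' h
      omega
  rw [h1, hrun.pulls_epoch (hs.trans s.2.le) hmem]
  exact ⟨hs, hmem⟩

/-- An arm is not pulled any more once it has been eliminated. -/
lemma IsSAERun.pulls_eq_of_notMem [Nonempty (Fin K)] (hL : 0 < level α T)
    (hrun : IsSAERun α a r) {e : ℕ} (he : (saeState α a r e).1 ≤ T) {j : Fin K}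
    (hj : j ∉ (saeState α a r e).2) : pulls a j T = pulls a j (saeState α a r e).1 := by
  refine pulls_eq_of_forall_ne a he le_rfl fun s hs _ hsj => ?_
  obtain ⟨e', h1, h2⟩ := exists_epoch (a := a) (r := r) hL s.val
  have h3 : e ≤ e' := by
    by_contra hlt
    have := saeState_fst_mono (α := α) (a := a) (r := r) (by omega : e' + 1 ≤ e)
    simp only at this
    omega
  exact hj (hsj ▸ saeState_subset h3 (hrun e' s h1 h2).1)

lemma pulls_saeSwitch (a : Fin T → Fin K) (i : Fin K) :
    pulls a i (saeSwitch a i) = pulls a i T := by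
  unfold pulls
  congr 1
  ext s
  simp only [Finset.mem_filter, Finset.mem_univ, true_and, s.2]
  refine and_iff_right_of_imp fun hs => ?_
  exact Finset.le_sup (f := fun t : Fin T => t.val + 1)
    (show s ∈ Finset.univ.filter fun t : Fin T => a t = i by simpa using hs)

/-- The comparison with which an arm survives an epoch. -/
lemma IsSAERun.lt_of_mem_succ (hrun : IsSAERun α a (tapeRewards x a)) {e : ℕ}
    (he : (saeState α a (tapeRewards x a) (e + 1)).1 ≤ T) {i j : Fin K} (hij : i ≠ j)
    (hi : i ∈ (saeState α a (tapeRewards x a) (e + 1)).2)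
    (hj : j ∈ (saeState α a (tapeRewards x a) e).2) :
    tapeMean (x j) (e + 1) - 2 * width α T (e + 1) < tapeMean (x i) (e + 1) := by
  obtain ⟨hi', h⟩ := mem_saeState_succ.1 hi
  have he' := (saeState_fst_mono (Nat.le_succ e)).trans he
  have := h (Finset.one_lt_card.2 ⟨i, hi', j, hj, hij⟩) j hj
  rw [empMean_tapeRewards _ _ _ he, empMean_tapeRewards _ _ _ he,
    hrun.pulls_epoch_succ he hj, hrun.pulls_epoch_succ he hi',
    hrun.pulls_epoch he' hj, hrun.pulls_epoch he' hi'] at this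
  exact this

/-- The comparison with which an arm is eliminated. -/
lemma IsSAERun.exists_le_of_notMem_succ (hrun : IsSAERun α a (tapeRewards x a)) {e : ℕ}
    (he : (saeState α a (tapeRewards x a) (e + 1)).1 ≤ T) {i : Fin K}
    (hi : i ∈ (saeState α a (tapeRewards x a) e).2)
    (hi' : i ∉ (saeState α a (tapeRewards x a) (e + 1)).2) :
    ∃ j, tapeMean (x i) (e + 1) ≤ tapeMean (x j) (e + 1) - 2 * width α T (e + 1) := by
  rw [mem_saeState_succ] at hi'
  push Not at hi'
  obtain ⟨-, j, hj, hle⟩ := hi' hi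
  have he' := (saeState_fst_mono (Nat.le_succ e)).trans he
  rw [empMean_tapeRewards _ _ _ he, empMean_tapeRewards _ _ _ he,
    hrun.pulls_epoch_succ he hj, hrun.pulls_epoch_succ he hi,
    hrun.pulls_epoch he' hj, hrun.pulls_epoch he' hi] at hle
  exact ⟨j, hle⟩

variable {μ : Fin K → ℝ} {istar i : Fin K}

/-- Two deviations amount to at most 7/4 of a width, short of the two widths that elimination
requires. -/
lemma IsSAERun.best_mem (h : LongHorizon α T μ istar) (hx : WithinWidth α T μ x)
    (hrun : IsSAERun α a (tapeRewards x a)) {e : ℕ}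
    (he : (saeState α a (tapeRewards x a) e).1 ≤ T) :
    istar ∈ (saeState α a (tapeRewards x a) e).2 := by
  have hL : 0 < level α T := zero_lt_one.trans_le h.one_le_level
  have : Nonempty (Fin K) := ⟨istar⟩
  induction e with
  | zero => exact Finset.mem_univ _
  | succ e ih =>
    have hmem := ih ((saeState_fst_mono (Nat.le_succ e)).trans he)
    by_contra hnot
    obtain ⟨j, hj⟩ := hrun.exists_le_of_notMem_succ he hmem hnot
    have heT := (le_saeState_fst hL (e + 1)).trans he
    have h1 := abs_le.1 (hx istar (e + 1) (by omega) heT)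
    have h2 := abs_le.1 (hx j (e + 1) (by omega) heT)
    have h3 : 0 < width α T (e + 1) := Real.sqrt_pos.2 (by positivity)
    linarith [h.mean_le j]

/-- Surviving next to the best arm with e + 1 pulls each forces Δ ≤ (2 + 7/4) · w(e + 1), so e + 1 ≤
28.2λ; one more pull costs at most λ. -/
lemma IsSAERun.pulls_le (h : LongHorizon α T μ istar) (hx : WithinWidth α T μ x)
    (hrun : IsSAERun α a (tapeRewards x a)) (hi : i ≠ istar) :
    (pulls a i T : ℝ) ≤ 30 * hardness α T μ istar i := by
  have hL : 0 < level α T := zero_lt_one.trans_le h.one_le_level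
  have : Nonempty (Fin K) := ⟨istar⟩
  have h1 := h.one_le_hardness hi
  rcases Nat.lt_or_ge (pulls a i T) 2 with hlt | hge
  · have : (pulls a i T : ℝ) ≤ 1 := by exact_mod_cast (by omega : pulls a i T ≤ 1)
    linarith
  · obtain ⟨e, he⟩ : ∃ e, pulls a i T = e + 2 := ⟨pulls a i T - 2, by omega⟩
    obtain ⟨s, -, hsi, hse⟩ := exists_pull_eq a (i := i) (k := e + 1) le_rfl (by omega)
    have h2 := hrun.epoch_pull hL s
    rw [hsi, hse] at h2
    have heT := h2.1.trans s.2.le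
    have h3 := hrun.lt_of_mem_succ heT hi h2.2
      (hrun.best_mem h hx ((saeState_fst_mono (Nat.le_succ e)).trans heT))
    have heT' := (le_saeState_fst hL (e + 1)).trans heT
    have h4 := abs_le.1 (hx istar (e + 1) (by omega) heT')
    have h5 := abs_le.1 (hx i (e + 1) (by omega) heT')
    have h6 := le_of_le_mul_width h.level_nonneg (n := e + 1) (by omega) (h.gap_pos hi)
      (q := 15 / 4) (by linarith)
    rw [he]
    push_cast at h6 ⊢
    unfold hardness at h1 ⊢
    linarith

/-- If i is eliminated with q + 1 pulls, then 2w(q + 1) ≤ Δ + 2ε; its survival with q pulls gives Δ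
- 2ε < 2w(q). The two sides differ by a width increment. -/
lemma sae_deterministic (h : LongHorizon α T μ istar) (hx : WithinWidth α T μ x)
    (hrun : IsSAERun α a (tapeRewards x a)) {ihat : (Fin T → Fin K) → Fin K}
    (hihat : IsMostPulled ihat) (hi : i ≠ istar) :
    hardness α T μ istar i / 64 ≤ pulls a i T ∧
      (pulls a i T : ℝ) ≤ 33 * hardness α T μ istar i ∧
      ∀ ε, WithinEps T μ x (hardness α T μ istar i / 28800) ε →
        |saeEstimate α ihat (μ istar) a i - μ i| ≤ 2 * ε + 1600 / hardness α T μ istar i := by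
  have hLpos : 0 < level α T := zero_lt_one.trans_le h.one_le_level
  have hne : Nonempty (Fin K) := ⟨istar⟩
  have hub : ∀ j, j ≠ istar → (pulls a j T : ℝ) ≤ 30 * hardness α T μ istar j :=
    fun j hj => hrun.pulls_le h hx hj
  have hhat : ihat a = istar := h.mostPulled_eq (by norm_num) (by norm_num) hub hihat
  have hstar := h.le_pulls_best (by norm_num) hub
  have hL := h.level_nonneg
  have hΔ := h.gap_pos hi
  have hlam := h.one_le_hardness hi
  have hlamT := h.hardness_le hi
  have hlamL := h.level_le_hardness hi
  have hubi := hub i hi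
  have hT : (64 : ℝ) ≤ T := by exact_mod_cast h.le_horizon
  have hdef : level α T / (μ istar - μ i) ^ 2 = hardness α T μ istar i := rfl
  set lam := hardness α T μ istar i with hlamdef
  obtain ⟨M, hM⟩ : ∃ M, pulls a istar T = M + 1 := by
    refine ⟨pulls a istar T - 1, ?_⟩
    have : (1 : ℝ) ≤ pulls a istar T := by linarith
    have : 1 ≤ pulls a istar T := by exact_mod_cast this
    omega
  -- arm `i` has been eliminated when the best arm is pulled for the last time
  obtain ⟨v, -, hv, hvM⟩ := exists_pull_eq a (i := istar) (k := M) le_rfl (by omega)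
  have hMT := (hrun.epoch_pull hLpos v).1
  rw [hv, hvM] at hMT
  -- An arm active in epoch M has M pulls, and M ≥ 34λ - 1 exceeds the bound 30λ for arm i.
  have hnotM : i ∉ (saeState α a (tapeRewards x a) M).2 := fun hmem => by
    have h1 := hrun.pulls_epoch (hMT.trans v.2.le) hmem
    have h2 := pulls_mono a i (hMT.trans v.2.le)
    rw [h1] at h2
    have h3 : (M : ℝ) ≤ pulls a i T := by exact_mod_cast h2
    rw [hM] at hstar
    push_cast at hstar
    linarith
  -- the epoch of the elimination
  classical
  have hex : ∃ e, i ∉ (saeState α a (tapeRewards x a) e).2 := ⟨M, hnotM⟩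
  obtain ⟨q, hq⟩ := Nat.exists_eq_succ_of_ne_zero
    (fun h0 : Nat.find hex = 0 => (h0 ▸ Nat.find_spec hex) (Finset.mem_univ i))
  have hout : i ∉ (saeState α a (tapeRewards x a) (q + 1)).2 := by
    have := Nat.find_spec hex
    rwa [hq] at this
  have hin : i ∈ (saeState α a (tapeRewards x a) q).2 :=
    not_not.1 (Nat.find_min hex (by omega))
  have hqT : (saeState α a (tapeRewards x a) (q + 1)).1 ≤ T :=
    (saeState_fst_mono (hq.symm.trans_le (Nat.find_min' hex hnotM))).trans (hMT.trans v.2.le)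
  have hqT' := (saeState_fst_mono (Nat.le_succ q)).trans hqT
  have hn : pulls a i T = q + 1 := by
    rw [hrun.pulls_eq_of_notMem hLpos hqT hout, hrun.pulls_epoch_succ hqT hin,
      hrun.pulls_epoch hqT' hin]
  have hnT : q + 1 ≤ T := (le_saeState_fst hLpos (q + 1)).trans hqT
  obtain ⟨j, hj⟩ := hrun.exists_le_of_notMem_succ hqT hin hout
  -- The eliminating arm j need not be the best one; `μ j ≤ μ istar` suffices, which is why
  -- deviations are controlled for all arms.
  have hjle := h.mean_le j
  have hnlam : lam / 8 ≤ (q + 1 : ℕ) := by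
    have h1 := abs_le.1 (hx i (q + 1) (by omega) hnT)
    have h2 := abs_le.1 (hx j (q + 1) (by omega) hnT)
    have h4 := le_mul_of_width_le hL (n := q + 1) (by omega) hΔ (q := 4) (by linarith)
    rw [hdef] at h4
    linarith
  rw [hn] at hubi ⊢
  refine ⟨by linarith, hubi.trans (by linarith), fun ε hε => ?_⟩
  have hest : saeEstimate α ihat (μ istar) a i - μ i =
      (μ istar - μ i) - 2 * width α T (q + 1) := by
    unfold saeEstimate
    rw [hhat, if_neg hi, pulls_saeSwitch, hn]
    ring
  rw [hest]
  have hwn : width α T (q + 1) ≤ 12 * (μ istar - μ i) :=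
    width_le_mul (by omega) (by norm_num) hΔ (by rw [hdef]; linarith)
  have hΔ1 : μ istar - μ i ≤ 1 := h.gap_le_one
  have hε0 : 0 ≤ ε := (abs_nonneg _).trans (hε istar T (by linarith) le_rfl)
  rcases Nat.eq_zero_or_pos q with rfl | hq1
  -- Elimination in the very first epoch leaves no survival to compare with; λ is bounded and 1600/λ
  -- covers the trivial error.
  · have hlam64 : lam ≤ 64 := by push_cast at hnlam; linarith
    have h1 : (25 : ℝ) ≤ 1600 / lam := by rw [le_div_iff₀ (by linarith)]; linarith
    have := width_nonneg (α := α) (T := T) (0 + 1)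
    rw [abs_le]
    constructor <;> linarith
  · obtain ⟨k, rfl⟩ : ∃ k, q = k + 1 := ⟨q - 1, by omega⟩
    have hk1' : (0 : ℝ) ≤ k := k.cast_nonneg
    have h3 := hrun.lt_of_mem_succ hqT' hi hin
      (hrun.best_mem h hx ((saeState_fst_mono (Nat.le_succ k)).trans hqT'))
    push_cast at hnlam
    have e1 := abs_le.1 (hε i (k + 1) (by push_cast; linarith) (by omega))
    have e2 := abs_le.1 (hε istar (k + 1) (by push_cast; linarith) (by omega))
    have e3 := abs_le.1 (hε i (k + 1 + 1) (by push_cast; linarith) hnT)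
    have e3' := abs_le.1 (hε j (k + 1 + 1) (by push_cast; linarith) hnT)
    have e4 := width_sub_le hL (n := k + 1) (by omega)
    have e5 : 2 * (2 * width α T (k + 1 + 1) / ((k + 1 : ℕ) + 1 : ℝ)) ≤ 1600 / lam := by
      rw [← mul_div_assoc, div_le_div_iff₀ (by positivity) (by linarith)]
      push_cast
      have : 2 * (2 * width α T (k + 1 + 1)) * lam ≤ 48 * lam := by
        gcongr
        linarith
      linarith
    have e6 : 0 ≤ 1600 / lam := by positivity
    rw [abs_le]
    constructor <;> linarith

end SAE

/-! ### Concentration of the tape averages -/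

section Concentration

/-- The tapes are only a.e. measurable, so `U` and `V` may fail to be measurable; their measurable
hulls have the same measure. -/
lemma integral_le_add_indicator {Ω : Type*} [MeasurableSpace Ω] {P : Measure Ω}
    [IsProbabilityMeasure P] {f : Ω → ℝ} (hf : Integrable f P) {U V : Set Ω} {A B D : ℝ}
    (hB : 0 ≤ B) (hD : 0 ≤ D)
    (h : ∀ᵐ ω ∂P, f ω ≤ A + U.indicator (fun _ => B) ω + V.indicator (fun _ => D) ω) :
    ∫ ω, f ω ∂P ≤ A + B * P.real U + D * P.real V := by
  have hU : Integrable ((toMeasurable P U).indicator fun _ => B) P :=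
    (integrable_const B).indicator (measurableSet_toMeasurable P U)
  have hV : Integrable ((toMeasurable P V).indicator fun _ => D) P :=
    (integrable_const D).indicator (measurableSet_toMeasurable P V)
  calc ∫ ω, f ω ∂P ≤ ∫ ω, (A + (toMeasurable P U).indicator (fun _ => B) ω +
        (toMeasurable P V).indicator (fun _ => D) ω) ∂P := by
        refine integral_mono_ae hf (((integrable_const A).add hU).add hV) ?_
        filter_upwards [h] with ω hω
        refine hω.trans (add_le_add (add_le_add le_rfl ?_) ?_)
        · exact Set.indicator_le_indicator_of_subset (subset_toMeasurable P U) (fun _ => hB) ω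
        · exact Set.indicator_le_indicator_of_subset (subset_toMeasurable P V) (fun _ => hD) ω
    _ = A + B * P.real U + D * P.real V := by
        have h1 : Integrable (fun ω => A + (toMeasurable P U).indicator (fun _ => B) ω) P :=
          (integrable_const A).add hU
        rw [integral_add h1 hV, integral_add (integrable_const A) hU,
          integral_indicator_const _ (measurableSet_toMeasurable P U),
          integral_indicator_const _ (measurableSet_toMeasurable P V)]
        simp only [integral_const, smul_eq_mul, Measure.real, measure_toMeasurable, measure_univ,
          ENNReal.toReal_one]
        ring

variable {K T : ℕ} {M : BanditInstance K} {Ω : Type*} [MeasurableSpace Ω] {P : Measure Ω}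
  [IsProbabilityMeasure P] {X : Fin K → ℕ → Ω → ℝ}

lemma BanditInstance.mean_mem (M : BanditInstance K) (j : Fin K) :
    M.mean j ∈ Set.Icc (0 : ℝ) 1 := by
  have := M.isProbabilityMeasure j
  have hs := M.support j
  have hint : Integrable (fun x : ℝ => x) (M.ν j) := Integrable.of_mem_Icc 0 1 aemeasurable_id' hs
  refine ⟨integral_nonneg_of_ae (hs.mono fun x hx => hx.1), ?_⟩
  refine (integral_mono_ae hint (integrable_const (1 : ℝ)) (hs.mono fun x hx => hx.2)).trans ?_
  simp

/-- Hoeffding's inequality for the tape averages. -/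
lemma BanditInstance.IsRewardTape.tail_le (hX : M.IsRewardTape T P X) (j : Fin K) {n : ℕ}
    (hn : 1 ≤ n) (hnT : n ≤ T) {s : ℝ} (hs : 0 ≤ s) :
    P.real {ω | s < |tapeMean (fun k => X j k ω) n - M.mean j|} ≤
      2 * Real.exp (-(2 * n * s ^ 2)) := by
  obtain ⟨hlaw, hind⟩ := hX
  have hn' : (0 : ℝ) < n := by exact_mod_cast hn
  set Y : Fin n → Ω → ℝ := fun k ω => X j k ω - M.mean j with hY
  have hYind : iIndepFun Y P := by
    have h1 : iIndepFun (fun k : Fin n => X j k) P := by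
      have := hind.precomp (g := fun k : Fin n => ((j, Fin.castLE hnT k) : Fin K × Fin T))
        (fun k l hkl => by simpa using hkl)
      exact this
    exact h1.comp (fun _ x => x - M.mean j) fun _ => measurable_id.sub_const _
  have hYsub : ∀ k ∈ (Finset.univ : Finset (Fin n)), HasSubgaussianMGF (Y k) ((1 / 2) ^ 2) P := by
    intro k _
    have hl := hlaw j k (k.2.trans_le hnT)
    have h1 := hasSubgaussianMGF_of_mem_Icc (a := 0) (b := 1) hl.aemeasurable
      ((hl.ae_iff (p := fun x => x ∈ Set.Icc (0 : ℝ) 1)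
        (measurableSet_Icc.mem)).2 (M.support j))
    have h2 : ∫ ω, X j k ω ∂P = M.mean j := hl.integral_eq
    rw [h2] at h1
    simpa using h1
  have hsum : ∀ ω, ∑ k, Y k ω = n * (tapeMean (fun k => X j k ω) n - M.mean j) := by
    intro ω
    simp only [hY, Finset.sum_sub_distrib, tapeMean, Finset.sum_const, Finset.card_univ,
      Fintype.card_fin, nsmul_eq_mul]
    rw [Fin.sum_univ_eq_sum_range (fun k => X j k ω) n]
    field_simp
  have hexp : -(n * s) ^ 2 / (2 * ((∑ _k : Fin n, (1 / 2) ^ 2 : NNReal) : ℝ)) =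
      -(2 * n * s ^ 2) := by
    simp only [Finset.sum_const, Finset.card_univ, Fintype.card_fin, nsmul_eq_mul]
    push_cast
    field_simp
  have h1 := HasSubgaussianMGF.measure_sum_ge_le_of_iIndepFun hYind hYsub
    (ε := n * s) (by positivity)
  have h2 := HasSubgaussianMGF.measure_sum_ge_le_of_iIndepFun
    (hYind.comp (fun _ x => -x) fun _ => measurable_neg) (fun k hk => (hYsub k hk).neg)
    (ε := n * s) (by positivity)
  rw [hexp] at h1 h2
  have hsub : {ω | s < |tapeMean (fun k => X j k ω) n - M.mean j|} ⊆
      {ω | n * s ≤ ∑ k, Y k ω} ∪ {ω | n * s ≤ ∑ k, ((fun x => -x) ∘ Y k) ω} := by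
    intro ω hω
    simp only [Function.comp, Set.mem_union, Set.mem_ofPred_eq, Finset.sum_neg_distrib, hsum ω]
      at hω ⊢
    rcases lt_abs.1 hω with h | h
    · left; gcongr
    · right
      rw [← mul_neg]
      gcongr
  calc _ ≤ _ := measureReal_mono hsub
    _ ≤ _ := measureReal_union_le _ _
    _ ≤ _ := by linarith

lemma BanditInstance.IsRewardTape.union_le (hX : M.IsRewardTape T P X) (S : Finset ℕ)
    (hS : ∀ n ∈ S, 1 ≤ n ∧ n ≤ T) {s : ℕ → ℝ} (hs : ∀ n ∈ S, 0 ≤ s n) :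
    P.real {ω | ¬ ∀ j, ∀ n ∈ S, |tapeMean (fun k => X j k ω) n - M.mean j| ≤ s n} ≤
      K * ∑ n ∈ S, 2 * Real.exp (-(2 * n * s n ^ 2)) := by
  have hsub : {ω | ¬ ∀ j, ∀ n ∈ S, |tapeMean (fun k => X j k ω) n - M.mean j| ≤ s n} ⊆
      ⋃ p ∈ (Finset.univ : Finset (Fin K)) ×ˢ S,
        {ω | s p.2 < |tapeMean (fun k => X p.1 k ω) p.2 - M.mean p.1|} := by
    intro ω hω
    simp only [Set.mem_ofPred_eq] at hω
    push Not at hω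
    obtain ⟨j, n, hn, h⟩ := hω
    simp only [Set.mem_iUnion]
    exact ⟨(j, n), by simp [hn], h⟩
  refine (measureReal_mono hsub (measure_ne_top P _)).trans
    ((measureReal_biUnion_finset_le _ _).trans ?_)
  rw [Finset.sum_product]
  calc _ ≤ ∑ _j : Fin K, ∑ n ∈ S, 2 * Real.exp (-(2 * n * s n ^ 2)) :=
        Finset.sum_le_sum fun j _ => Finset.sum_le_sum fun n hn =>
          hX.tail_le j (hS n hn).1 (hS n hn).2 (hs n hn)
    _ = _ := by simp

/-- The Hoeffding exponent is 4 · (7/8)² · L = 49/16 · L, free of n. The factor 7/8 keeps it above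
3L and yet leaves an eighth of a width to spare. -/
lemma BanditInstance.IsRewardTape.not_withinWidth_le {α : ℝ} (hX : M.IsRewardTape T P X)
    (hL : 0 ≤ level α T) :
    P.real {ω | ¬ WithinWidth α T M.mean (fun j k => X j k ω)} ≤
      2 * K * T * Real.exp (-(3 * level α T)) := by
  have h := hX.union_le (Finset.Icc 1 T) (fun n hn => Finset.mem_Icc.1 hn)
    (s := fun n => 7 / 8 * width α T n) (fun n _ => mul_nonneg (by norm_num) (width_nonneg n))
  have hset : {ω | ¬ WithinWidth α T M.mean (fun j k => X j k ω)} =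
      {ω | ¬ ∀ j, ∀ n ∈ Finset.Icc 1 T,
        |tapeMean (fun k => X j k ω) n - M.mean j| ≤ 7 / 8 * width α T n} := by
    ext ω
    simp only [WithinWidth, Finset.mem_Icc, and_imp, Set.mem_ofPred_eq]
  rw [hset]
  refine h.trans ?_
  calc _ ≤ (K : ℝ) * ∑ _n ∈ Finset.Icc 1 T, 2 * Real.exp (-(3 * level α T)) := by
        refine mul_le_mul_of_nonneg_left (Finset.sum_le_sum fun n hn => ?_) K.cast_nonneg
        have hn' : (0 : ℝ) < n := by exact_mod_cast (Finset.mem_Icc.1 hn).1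
        rw [mul_pow, width_sq hL]
        have : 2 * (n : ℝ) * ((7 / 8) ^ 2 * (2 * level α T / n)) = 49 / 16 * level α T := by
          field_simp; ring
        rw [this]
        gcongr
        norm_num
    _ = _ := by simp; ring

/-- Half of the exponent is spent on the start n ≥ b, giving (λK)⁻³, and half on decay in n, giving
(λ/n)². The sum over n converges, so T does not enter. -/
lemma BanditInstance.IsRewardTape.not_withinEps_le (hX : M.IsRewardTape T P X) (hK : 1 ≤ K)
    {lam b ε : ℝ} (hlam : 1 ≤ lam) (hb : 0 < b) (hε : 0 ≤ ε) (hε1 : 1 ≤ lam * ε ^ 2)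
    (hε2 : 3 * Real.log (lam * K) ≤ b * ε ^ 2) :
    P.real {ω | ¬ WithinEps T M.mean (fun j k => X j k ω) b ε} ≤ 4 / lam := by
  classical
  have hK' : (1 : ℝ) ≤ K := by exact_mod_cast hK
  have hlam0 : 0 < lam := by linarith
  have hεpos : 0 < ε ^ 2 := by
    by_contra hle
    nlinarith [sq_nonneg ε]
  set S := (Finset.Icc 1 T).filter fun n : ℕ => b ≤ n with hS
  have h := hX.union_le S (fun n hn => Finset.mem_Icc.1 (Finset.mem_filter.1 hn).1)
    (s := fun _ => ε) (fun _ _ => hε)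
  have hset : {ω | ¬ WithinEps T M.mean (fun j k => X j k ω) b ε} ⊆
      {ω | ¬ ∀ j, ∀ n ∈ S, |tapeMean (fun k => X j k ω) n - M.mean j| ≤ ε} := by
    intro ω hω hall
    refine hω fun j n hbn hnT => hall j n ?_
    have : (0 : ℝ) < n := hb.trans_le hbn
    have : 0 < n := by exact_mod_cast this
    simp only [hS, Finset.mem_filter, Finset.mem_Icc]
    exact ⟨⟨this, hnT⟩, hbn⟩
  refine (measureReal_mono hset).trans (h.trans ?_)
  have hterm : ∀ n ∈ S, 2 * Real.exp (-(2 * n * ε ^ 2)) ≤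
      2 * (((lam * K) ^ 3)⁻¹ * lam ^ 2) * ((n : ℝ) ^ 2)⁻¹ := by
    intro n hn
    obtain ⟨hn1, hbn⟩ := Finset.mem_filter.1 hn
    have hn' : (0 : ℝ) < n := by exact_mod_cast (Finset.mem_Icc.1 hn1).1
    have e1 : Real.exp (-(n * ε ^ 2)) ≤ ((lam * K) ^ 3)⁻¹ := by
      rw [Real.exp_neg]
      refine inv_anti₀ (by positivity) ?_
      rw [← Real.log_le_iff_le_exp (by positivity), Real.log_pow]
      push_cast
      exact hε2.trans (by gcongr)
    have e2 : Real.exp (-(n * ε ^ 2)) ≤ lam ^ 2 * ((n : ℝ) ^ 2)⁻¹ := by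
      have e3 : (n / lam : ℝ) ^ 2 ≤ Real.exp (n * ε ^ 2) := by
        have e4 : (n / lam : ℝ) ≤ n * ε ^ 2 := by
          rw [div_le_iff₀ hlam0]
          nlinarith
        have e5 : n * ε ^ 2 ≤ Real.exp (n * ε ^ 2 / 2) := by
          have h0 : 0 ≤ n * ε ^ 2 / 2 := by positivity
          have := Real.quadratic_le_exp_of_nonneg h0
          nlinarith [sq_nonneg (n * ε ^ 2 / 2 - 1)]
        calc (n / lam : ℝ) ^ 2 ≤ Real.exp (n * ε ^ 2 / 2) ^ 2 := by
              gcongr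
              exact e4.trans e5
          _ = _ := by rw [← Real.exp_nat_mul]; congr 1; push_cast; ring
      rw [Real.exp_neg]
      refine (inv_anti₀ (by positivity) e3).trans_eq ?_
      rw [div_pow, inv_div, div_eq_mul_inv]
    have e6 : Real.exp (-(2 * n * ε ^ 2)) =
        Real.exp (-(n * ε ^ 2)) * Real.exp (-(n * ε ^ 2)) := by
      rw [← Real.exp_add]; congr 1; ring
    rw [e6]
    have := mul_le_mul e1 e2 (Real.exp_nonneg _) (by positivity)
    linarith
  have hsq : ∑ n ∈ S, ((n : ℝ) ^ 2)⁻¹ ≤ 2 := by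
    have h1 := sum_Ioo_inv_sq_le (α := ℝ) 0 (T + 1)
    refine (Finset.sum_le_sum_of_subset_of_nonneg ?_ fun _ _ _ => by positivity).trans
      (h1.trans (by norm_num))
    intro n hn
    have := Finset.mem_Icc.1 (Finset.mem_filter.1 hn).1
    exact Finset.mem_Ioo.2 ⟨by omega, by omega⟩
  calc (K : ℝ) * ∑ n ∈ S, 2 * Real.exp (-(2 * n * ε ^ 2))
      ≤ K * ∑ n ∈ S, 2 * (((lam * K) ^ 3)⁻¹ * lam ^ 2) * ((n : ℝ) ^ 2)⁻¹ := by
        exact mul_le_mul_of_nonneg_left (Finset.sum_le_sum hterm) K.cast_nonneg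
    _ ≤ K * (2 * (((lam * K) ^ 3)⁻¹ * lam ^ 2) * 2) := by
        rw [← Finset.mul_sum]
        gcongr
    _ = 4 / (lam * (K : ℝ) ^ 2) := by field_simp; norm_num
    _ ≤ 4 / lam := by
        gcongr
        exact le_mul_of_one_le_right hlam0.le (one_le_pow₀ hK')

end Concentration

/-! ### From the good event to expectations -/

section Expectation

lemma log_le_level {α : ℝ} (hα : 0 ≤ α) {T : ℕ} (hT : 2 ≤ T) : Real.log T ≤ level α T := by
  unfold level
  split_ifs with h
  · exact le_rfl
  · have hα' : 0 < α := lt_of_le_of_ne hα (Ne.symm h)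
    have hT' : (0 : ℝ) < T := by exact_mod_cast (by omega : 0 < T)
    rw [le_div_iff₀ hα', Real.rpow_def_of_pos hT']
    linarith [Real.add_one_le_exp (Real.log T * α)]

variable {K T : ℕ} {α : ℝ} {M : BanditInstance K} {istar i : Fin K}

/-- A bootstrap from T ≥ 2: T ≥ 64 log T ≥ 64 log 2 > 4, hence log T ≥ log 4 > 1, hence T ≥ 64 and L
≥ 1. -/
lemma BanditInstance.IsUniqueBest.longHorizon (hbest : M.IsUniqueBest istar) (hα : 0 ≤ α)
    (hT : 2 ≤ T) (hsum : 64 * ∑ j ∈ Finset.univ.erase istar, level α T / (M.gap istar j) ^ 2 ≤ T)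
    (hi : i ≠ istar) : LongHorizon α T M.mean istar := by
  have hlog2 := Real.log_two_gt_d9
  have hlog : Real.log 2 ≤ Real.log T :=
    Real.log_le_log (by norm_num) (by exact_mod_cast hT)
  have hlevel := log_le_level hα hT
  have h1 : level α T ≤ level α T / (M.gap istar i) ^ 2 := by
    have h2 : 0 < M.gap istar i := sub_pos.2 (hbest i hi)
    have h3 : M.gap istar i ≤ 1 := by
      unfold BanditInstance.gap
      linarith [(M.mean_mem istar).2, (M.mean_mem i).1]
    exact le_div_self (by linarith) (by positivity) (pow_le_one₀ h2.le h3)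
  have h2 : level α T / (M.gap istar i) ^ 2 ≤
      ∑ j ∈ Finset.univ.erase istar, level α T / (M.gap istar j) ^ 2 :=
    Finset.single_le_sum (f := fun j => level α T / (M.gap istar j) ^ 2)
      (fun j _ => div_nonneg (by linarith) (by positivity))
      (Finset.mem_erase.2 ⟨hi, Finset.mem_univ i⟩)
  have h3 : 64 * Real.log T ≤ T := by linarith
  have h4 : (4 : ℝ) ≤ T := by linarith
  have h5 : Real.log 4 ≤ Real.log T := Real.log_le_log (by norm_num) h4
  have h6 : Real.log 4 = 2 * Real.log 2 := by
    rw [show (4 : ℝ) = 2 ^ 2 by norm_num, Real.log_pow]; norm_num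
  have h7 : (64 : ℝ) ≤ T := by linarith
  exact ⟨M.mean_mem, hbest, by linarith, by exact_mod_cast h7, hsum⟩

/-- Each suboptimal arm has hardness at least 1, so K - 1 ≤ T/64, and K ≤ 2(K - 1). -/
lemma LongHorizon.card_le {μ : Fin K → ℝ} (h : LongHorizon α T μ istar) (hi : i ≠ istar) :
    (2 : ℝ) ≤ K ∧ 32 * (K : ℝ) ≤ T := by
  have hK : 2 ≤ K := by
    have h1 := i.2
    have h2 := istar.2
    by_contra hlt
    exact hi (Fin.ext (by omega))
  have h1 : ((K : ℝ) - 1) ≤ ∑ j ∈ Finset.univ.erase istar, hardness α T μ istar j := by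
    calc ((K : ℝ) - 1) = ∑ _j ∈ Finset.univ.erase istar, (1 : ℝ) := by
          rw [Finset.sum_const, Finset.card_erase_of_mem (Finset.mem_univ _), Finset.card_univ,
            Fintype.card_fin, nsmul_eq_mul, mul_one, Nat.cast_sub (by omega), Nat.cast_one]
      _ ≤ _ := Finset.sum_le_sum fun j hj => h.one_le_hardness (Finset.ne_of_mem_erase hj)
  have h2 := h.sum_hardness
  have hK' : (2 : ℝ) ≤ K := by exact_mod_cast hK
  exact ⟨hK', by linarith⟩

/-- A crude constant deviation on the good event, for when the finer one fails: n ≥ λ/28800 gives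
w(n) ≤ 240Δ, and 210 = 7/8 · 240. -/
lemma LongHorizon.withinEps {μ : Fin K → ℝ} {x : Fin K → ℕ → ℝ} (h : LongHorizon α T μ istar)
    (hi : i ≠ istar) (hx : WithinWidth α T μ x) :
    WithinEps T μ x (hardness α T μ istar i / 28800) 210 := by
  intro j n hn hnT
  have hn0 : (0 : ℝ) < n := lt_of_lt_of_le (by linarith [h.one_le_hardness hi]) hn
  have hn1 : 1 ≤ n := by exact_mod_cast hn0
  have h1 : width α T n ≤ 240 * (μ istar - μ i) :=
    width_le_mul hn1 (by norm_num) (h.gap_pos hi) (by unfold hardness at hn; linarith)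
  linarith [hx j n hn1 hnT, h.gap_le_one (i := i)]

/-- The logarithm on the right must stay away from 0. This is why n ≥ 15/16 is needed besides n ≥
λ/69: with k ≥ 2 it gives y = n√k ≥ 1.3, so a fixed power y¹⁸ dominates λk. -/
lemma sqrt_log_div_le {lam k n : ℝ} (hlam : 1 ≤ lam) (hk : 2 ≤ k) (hn : 15 / 16 ≤ n)
    (hl : lam ≤ 69 * n) (hu : n ≤ 34 * lam) :
    √(Real.log (lam * k) / lam) ≤ 25 * √(Real.log (n * √k) / n) := by
  have hk0 : 0 < √k := Real.sqrt_pos.2 (by linarith)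
  have hsq : √k ^ 2 = k := Real.sq_sqrt (by linarith)
  set y := n * √k with hy
  have hy0 : 0 < y := by positivity
  have hy2 : y ^ 2 = n ^ 2 * k := by rw [hy, mul_pow, hsq]
  have hn2 : (15 / 16 : ℝ) ^ 2 ≤ n ^ 2 := by gcongr
  have hy2' : (15 / 16 : ℝ) ^ 2 * 2 ≤ y ^ 2 := by
    rw [hy2]
    gcongr
  have h16 : (69 * (16 / 15) : ℝ) ≤ y ^ 16 := by
    calc (69 * (16 / 15) : ℝ) ≤ ((15 / 16 : ℝ) ^ 2 * 2) ^ 8 := by norm_num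
      _ ≤ (y ^ 2) ^ 8 := by gcongr
      _ = y ^ 16 := by ring
  have hle : lam * k ≤ y ^ 18 := by
    calc lam * k ≤ 69 * n * k := by gcongr
      _ ≤ 69 * (16 / 15 * n ^ 2) * k := by
          have : n ≤ 16 / 15 * n ^ 2 := by nlinarith
          have h2 : 69 * n ≤ 69 * (16 / 15 * n ^ 2) := by linarith
          gcongr
      _ = 69 * (16 / 15) * y ^ 2 := by rw [hy2]; ring
      _ ≤ y ^ 16 * y ^ 2 := by gcongr
      _ = y ^ 18 := by ring
  have hlog : Real.log (lam * k) ≤ 18 * Real.log y := by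
    have := Real.log_le_log (by positivity) hle
    rwa [Real.log_pow] at this
  have hlog0 : 0 ≤ Real.log y := by
    have : 0 ≤ Real.log (lam * k) := Real.log_nonneg (by nlinarith)
    linarith
  have hn0 : 0 < n := by linarith
  rw [show (25 : ℝ) = √(25 ^ 2) by rw [Real.sqrt_sq (by norm_num)], ← Real.sqrt_mul (by norm_num)]
  refine Real.sqrt_le_sqrt ?_
  rw [← mul_div_assoc, div_le_div_iff₀ (by linarith) hn0]
  calc Real.log (lam * k) * n ≤ 18 * Real.log y * (34 * lam) := by gcongr
    _ ≤ 25 ^ 2 * Real.log y * lam := by nlinarith [mul_nonneg hlog0 (by linarith : 0 ≤ lam)]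

variable {Ω : Type*} [MeasurableSpace Ω] {P : Measure Ω} [IsProbabilityMeasure P]
  {X : Fin K → ℕ → Ω → ℝ}

lemma BanditInstance.IsRewardTape.measure_not_withinWidth_le (hX : M.IsRewardTape T P X)
    (h : LongHorizon α T M.mean istar) (hlevel : Real.log T ≤ level α T) (hi : i ≠ istar) :
    P.real {ω | ¬ WithinWidth α T M.mean (fun j k => X j k ω)} ≤ 1 / (16 * T) := by
  have hT : (64 : ℝ) ≤ T := by exact_mod_cast h.le_horizon
  have hT0 : (0 : ℝ) < T := by linarith
  refine (hX.not_withinWidth_le h.level_nonneg).trans ?_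
  have hexp : Real.exp (-(3 * level α T)) ≤ ((T : ℝ) ^ 3)⁻¹ := by
    rw [Real.exp_neg]
    refine inv_anti₀ (by positivity) ?_
    rw [← Real.log_le_iff_le_exp (by positivity), Real.log_pow]
    push_cast
    linarith
  have hK := (h.card_le hi).2
  calc 2 * K * T * Real.exp (-(3 * level α T)) ≤ 2 * (T / 32) * T * ((T : ℝ) ^ 3)⁻¹ := by
        gcongr
        linarith
    _ = 1 / (16 * T) := by field_simp; norm_num

/-- Three regimes: outside `V` and `U` the fine bound holds; on `U` outside `V` the error is at most
2 · 210 + 1600 = 2020 while P(U) ≤ 4/λ; on `V` the error is of order √L ≤ √λ while P(V) ≤ 1/(16T).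
-/
lemma BanditInstance.IsRewardTape.expectation_bounds (hX : M.IsRewardTape T P X)
    (h : LongHorizon α T M.mean istar) (hlevel : Real.log T ≤ level α T) (hi : i ≠ istar)
    {N : Ω → ℕ} (hNint : Integrable (fun ω => (N ω : ℝ)) P) (hNT : ∀ ω, N ω ≤ T)
    {err : Ω → ℝ} (hint : Integrable err P) (herr : ∀ ω, err ω ≤ 1 + 2 * √(2 * level α T))
    (hdet : ∀ᵐ ω ∂P, WithinWidth α T M.mean (fun j k => X j k ω) →
      hardness α T M.mean istar i / 64 ≤ N ω ∧ (N ω : ℝ) ≤ 33 * hardness α T M.mean istar i ∧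
      ∀ ε, WithinEps T M.mean (fun j k => X j k ω) (hardness α T M.mean istar i / 28800) ε →
        err ω ≤ 2 * ε + 1600 / hardness α T M.mean istar i) :
    ∫ ω, err ω ∂P ≤ 500000 * √(Real.log ((∫ ω, (N ω : ℝ) ∂P) * √K) / ∫ ω, (N ω : ℝ) ∂P) ∧
      1 / 69 * hardness α T M.mean istar i ≤ ∫ ω, (N ω : ℝ) ∂P := by
  have hV := hX.measure_not_withinWidth_le h hlevel hi
  set V := {ω | ¬ WithinWidth α T M.mean (fun j k => X j k ω)} with hVdef
  have hlam := h.one_le_hardness hi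
  have hlamT := h.hardness_le hi
  have hlamL := h.level_le_hardness hi
  have hT : (64 : ℝ) ≤ T := by exact_mod_cast h.le_horizon
  have hL := h.one_le_level
  obtain ⟨hK, -⟩ := h.card_le hi
  set lam := hardness α T M.mean istar i with hlamdef
  have hlam0 : 0 < lam := by linarith
  have hV' : P.real V ≤ 1 / 1024 :=
    hV.trans (one_div_le_one_div_of_le (by norm_num) (by linarith))
  have hTV : T * P.real V ≤ 1 / 16 := by
    calc T * P.real V ≤ T * (1 / (16 * T)) := by gcongr
      _ = 1 / 16 := by field_simp
  -- the expected number of pulls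
  have hNle : ∫ ω, (N ω : ℝ) ∂P ≤ 34 * lam := by
    have h1 := integral_le_add_indicator (U := ∅) (V := V) (A := 33 * lam) (B := 0) (D := T)
      hNint le_rfl (by linarith) (by
        filter_upwards [hdet] with ω hω
        have hNT' : (N ω : ℝ) ≤ T := by exact_mod_cast hNT ω
        by_cases hωV : ω ∈ V
        · simp only [Set.indicator_of_mem hωV, Set.indicator_empty]
          linarith
        · simp only [Set.indicator_of_notMem hωV, Set.indicator_empty]
          linarith [(hω (not_not.1 hωV)).2.1])
    linarith
  have hge : ∀ A : ℝ, 0 ≤ A →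
      (∀ᵐ ω ∂P, WithinWidth α T M.mean (fun j k => X j k ω) → A ≤ N ω) →
      15 / 16 * A ≤ ∫ ω, (N ω : ℝ) ∂P := by
    intro A hA hAN
    have h1 := integral_le_add_indicator (f := fun ω => -(N ω : ℝ)) (U := ∅) (V := V)
      (A := -A) (B := 0) (D := A) hNint.neg le_rfl hA (by
        filter_upwards [hAN] with ω hω
        have hN0 : (0 : ℝ) ≤ N ω := Nat.cast_nonneg _
        by_cases hωV : ω ∈ V
        · simp only [Set.indicator_of_mem hωV, Set.indicator_empty]
          linarith
        · simp only [Set.indicator_of_notMem hωV, Set.indicator_empty]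
          linarith [hω (not_not.1 hωV)])
    rw [integral_neg] at h1
    nlinarith
  have hN1 : 15 / 16 ≤ ∫ ω, (N ω : ℝ) ∂P := by
    have := hge 1 zero_le_one (by
      filter_upwards [hdet] with ω hω hx
      have h1 : (0 : ℝ) < N ω := lt_of_lt_of_le (by positivity) (hω hx).1
      have h2 : 0 < N ω := by exact_mod_cast h1
      exact_mod_cast h2)
    linarith
  have hNlam : 1 / 69 * lam ≤ ∫ ω, (N ω : ℝ) ∂P := by
    have := hge (lam / 64) (by positivity) (by
      filter_upwards [hdet] with ω hω hx using (hω hx).1)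
    linarith
  refine ⟨?_, hNlam⟩
  -- the expected error
  have hlog : 1 / 4 ≤ Real.log (lam * K) := by
    have h1 : Real.log 2 ≤ Real.log (lam * K) := Real.log_le_log (by norm_num) (by nlinarith)
    linarith [Real.log_two_gt_d9]
  set R := √(Real.log (lam * K) / lam) with hR
  have hR0 : 0 ≤ R := Real.sqrt_nonneg _
  have hRsq : lam * R ^ 2 = Real.log (lam * K) := by
    rw [hR, Real.sq_sqrt (by positivity)]
    field_simp
  -- The factor 294 satisfies 294²/28800 ≥ 3, as the union bound requires.
  have hU := hX.not_withinEps_le (lam := lam) (b := lam / 28800) (ε := 294 * R)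
    (by have : (1 : ℝ) ≤ K := by linarith
        exact_mod_cast this) hlam (by positivity) (by positivity)
    (by nlinarith) (by nlinarith)
  set U := {ω | ¬ WithinEps T M.mean (fun j k => X j k ω) (lam / 28800) (294 * R)} with hUdef
  have hE := integral_le_add_indicator (U := U) (V := V) (A := 2 * (294 * R) + 1600 / lam)
    (B := 2020) (D := 1 + 2 * √(2 * level α T)) hint (by norm_num) (by positivity) (by
      filter_upwards [hdet] with ω hω
      have h0 : 0 ≤ 1600 / lam := by positivity
      have hUnn : (0 : ℝ) ≤ U.indicator (fun _ => (2020 : ℝ)) ω :=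
        Set.indicator_nonneg (fun _ _ => by norm_num) ω
      by_cases hωV : ω ∈ V
      · simp only [Set.indicator_of_mem hωV]
        linarith [herr ω]
      · have hg := not_not.1 hωV
        simp only [Set.indicator_of_notMem hωV]
        by_cases hωU : ω ∈ U
        · simp only [Set.indicator_of_mem hωU]
          have h1 := (hω hg).2.2 210 (h.withinEps hi hg)
          have h2 : 1600 / lam ≤ 1600 := div_le_self (by norm_num) hlam
          linarith
        · linarith [(hω hg).2.2 _ (not_not.1 hωU)])
  have hinv : 1 / √lam ≤ 2 * R := by
    have h1 : 1 / √lam = √(1 / lam) := by rw [Real.sqrt_div' _ hlam0.le, Real.sqrt_one]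
    rw [h1, show (2 : ℝ) = √(2 ^ 2) by rw [Real.sqrt_sq (by norm_num)], hR,
      ← Real.sqrt_mul (by norm_num)]
    refine Real.sqrt_le_sqrt ?_
    rw [← mul_div_assoc]
    gcongr
    linarith
  have hsq1 : 1 ≤ √lam := Real.one_le_sqrt.2 hlam
  have hsqlam : √lam * √lam = lam := Real.mul_self_sqrt hlam0.le
  have hinv2 : 1 / lam ≤ 1 / √lam :=
    one_div_le_one_div_of_le (by linarith) (by nlinarith)
  have hDV : (1 + 2 * √(2 * level α T)) * P.real V ≤ 1 / √lam := by
    have h1 : 1 + 2 * √(2 * level α T) ≤ 4 * √lam := by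
      have h2 : √(2 * level α T) ≤ √2 * √lam := by
        rw [← Real.sqrt_mul (by norm_num)]
        exact Real.sqrt_le_sqrt (by linarith)
      have h3 : √2 ≤ 3 / 2 := Real.sqrt_le_iff.2 ⟨by norm_num, by norm_num⟩
      have h4 : √2 * √lam ≤ 3 / 2 * √lam := by gcongr
      linarith
    calc _ ≤ 4 * √lam * (1 / (16 * T)) := by gcongr
      _ ≤ 4 * √lam * (1 / (4 * lam)) := by
          gcongr <;> linarith
      _ = 1 / √lam := by
          rw [eq_div_iff (by positivity)]
          calc _ = √lam * √lam / lam := by ring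
            _ = 1 := by rw [hsqlam, div_self hlam0.ne']
  have h1600 : 1600 / lam = 1600 * (1 / lam) := by ring
  have h4 : 4 / lam = 4 * (1 / lam) := by ring
  rw [h4] at hU
  rw [h1600] at hE
  have hfinal := sqrt_log_div_le hlam hK hN1 (by linarith) hNle
  -- With 1/λ ≤ 1/√λ ≤ 2R the terms add up to (588 + 3200 + 16160 + 2)R.
  calc ∫ ω, err ω ∂P ≤ 20000 * R := by linarith
    _ ≤ 20000 * (25 * √(Real.log ((∫ ω, (N ω : ℝ) ∂P) * √K) / ∫ ω, (N ω : ℝ) ∂P)) := by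
        gcongr
    _ = _ := by ring

/-- Both estimators are functions of the action sequence, hence integrable. -/
lemma integrable_comp_actions {I : Fin T → Ω → Fin K} (hI : ∀ t, Measurable (I t))
    (f : (Fin T → Fin K) → ℝ) : Integrable (fun ω => f fun t => I t ω) P := by
  have hmeas : Measurable fun ω => (fun t => I t ω) := measurable_pi_lambda _ hI
  obtain ⟨B, hB⟩ := (Set.finite_range fun a => ‖f a‖).bddAbove
  exact Integrable.of_bound ((measurable_of_finite f).comp hmeas).aestronglyMeasurable B
    (Filter.Eventually.of_forall fun ω => hB ⟨_, rfl⟩)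

/-- The bound for the bad event, valid for every action sequence. -/
lemma abs_saeEstimate_sub_le (hL : 0 ≤ level α T) (ihat : (Fin T → Fin K) → Fin K)
    (a : Fin T → Fin K) (j : Fin K) :
    |saeEstimate α ihat (M.mean istar) a j - M.mean j| ≤ 1 + 2 * √(2 * level α T) := by
  have h1 := M.mean_mem istar
  have h2 := M.mean_mem j
  have h3 := Real.sqrt_nonneg (2 * level α T)
  have h4 := width_le hL (pulls a j (saeSwitch a j))
  have h5 := width_nonneg (α := α) (T := T) (pulls a j (saeSwitch a j))
  unfold saeEstimate
  rw [abs_le]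
  split_ifs <;> constructor <;> linarith [h1.1, h1.2, h2.1, h2.2]

lemma abs_ucbEstimate_sub_le (hL : 0 ≤ level α T) (ihat : (Fin T → Fin K) → Fin K)
    (a : Fin T → Fin K) (j : Fin K) :
    |ucbEstimate α ihat (M.mean istar) a j - M.mean j| ≤ 1 + 2 * √(2 * level α T) := by
  have h1 := M.mean_mem istar
  have h2 := M.mean_mem j
  have h3 := Real.sqrt_nonneg (2 * level α T)
  have h4 := width_le hL (pulls a j (ucbSwitch a (ihat a) j))
  have h5 := width_nonneg (α := α) (T := T) (pulls a j (ucbSwitch a (ihat a) j))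
  have h6 := width_le hL (pulls a (ihat a) (ucbSwitch a (ihat a) j))
  have h7 := width_nonneg (α := α) (T := T) (pulls a (ihat a) (ucbSwitch a (ihat a) j))
  unfold ucbEstimate
  rw [abs_le]
  split_ifs <;> constructor <;> linarith [h1.1, h1.2, h2.1, h2.2]

end Expectation

end InverseBandit

theorem theorem2 :
    ∃ C c : ℝ, 0 < C ∧ 0 < c ∧
      ∀ (K T : ℕ) (α : ℝ), 0 ≤ α → α < 1 → 2 ≤ T →
      ∀ (M : InverseBandit.BanditInstance K) (istar : Fin K), M.IsUniqueBest istar →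
      64 * ∑ j ∈ Finset.univ.erase istar,
        InverseBandit.level α T / (M.gap istar j) ^ 2 ≤ (T : ℝ) →
      ∀ (Ω : Type*) [MeasurableSpace Ω] (P : Measure Ω) [IsProbabilityMeasure P]
        (X : Fin K → ℕ → Ω → ℝ), M.IsRewardTape T P X →
      ∀ I : Fin T → Ω → Fin K, (∀ t, Measurable (I t)) →
      ∀ ihat : (Fin T → Fin K) → Fin K, InverseBandit.IsMostPulled ihat →
      ∀ i : Fin K, i ≠ istar →
        ((∀ᵐ ω ∂P, InverseBandit.IsSAERun α (fun t => I t ω)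
            (InverseBandit.tapeRewards (fun j n => X j n ω) (fun t => I t ω))) →
          Integrable (fun ω => |InverseBandit.saeEstimate α ihat (M.mean istar)
              (fun t => I t ω) i - M.mean i|) P ∧
          ∫ ω, |InverseBandit.saeEstimate α ihat (M.mean istar)
              (fun t => I t ω) i - M.mean i| ∂P
            ≤ C * Real.sqrt (Real.log (InverseBandit.expectedPulls P I i * Real.sqrt K)
                / InverseBandit.expectedPulls P I i) ∧
          c * (InverseBandit.level α T / (M.gap istar i) ^ 2)
            ≤ InverseBandit.expectedPulls P I i) ∧
        ((∀ᵐ ω ∂P, InverseBandit.IsUCBRun α (fun t => I t ω)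
            (InverseBandit.tapeRewards (fun j n => X j n ω) (fun t => I t ω))) →
          Integrable (fun ω => |InverseBandit.ucbEstimate α ihat (M.mean istar)
              (fun t => I t ω) i - M.mean i|) P ∧
          ∫ ω, |InverseBandit.ucbEstimate α ihat (M.mean istar)
              (fun t => I t ω) i - M.mean i| ∂P
            ≤ C * Real.sqrt (Real.log (InverseBandit.expectedPulls P I i * Real.sqrt K)
                / InverseBandit.expectedPulls P I i) ∧
          c * (InverseBandit.level α T / (M.gap istar i) ^ 2)
            ≤ InverseBandit.expectedPulls P I i) := by
  -- 500000 = 20000 · 25, and 1/69 is just below 15/16 · 1/64.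
  refine ⟨500000, 1 / 69, by norm_num, by norm_num, ?_⟩
  intro K T α hα _ hT M istar hbest hsum Ω _ P _ X hX I hI ihat hihat i hi
  have h := hbest.longHorizon hα hT hsum hi
  have hlevel := InverseBandit.log_le_level hα hT
  have hN := InverseBandit.integrable_comp_actions (P := P) hI
    fun a => (InverseBandit.pulls a i T : ℝ)
  refine ⟨fun hrun => ?_, fun hrun => ?_⟩
  · have hint := InverseBandit.integrable_comp_actions (P := P) hI
      fun a => |InverseBandit.saeEstimate α ihat (M.mean istar) a i - M.mean i|
    refine ⟨hint, hX.expectation_bounds h hlevel hi hN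
      (fun ω => InverseBandit.pulls_le _ _ _) hint
      (fun ω => InverseBandit.abs_saeEstimate_sub_le h.level_nonneg ihat _ i) ?_⟩
    filter_upwards [hrun] with ω hω hx
    exact InverseBandit.sae_deterministic h hx hω hihat hi
  · have hint := InverseBandit.integrable_comp_actions (P := P) hI
      fun a => |InverseBandit.ucbEstimate α ihat (M.mean istar) a i - M.mean i|
    refine ⟨hint, hX.expectation_bounds h hlevel hi hN
      (fun ω => InverseBandit.pulls_le _ _ _) hint
      (fun ω => InverseBandit.abs_ucbEstimate_sub_le h.level_nonneg ihat _ i) ?_⟩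
    filter_upwards [hrun] with ω hω hx
    exact InverseBandit.ucb_deterministic h hx hω hihat hi
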